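/- Fix a free ultrafilter $\omega$ on $\mathbb{N}$. For a $\mathrm{C}^*$-algebra $A$ let $\ell^\infty(A)$ be the $\mathrm{C}^*$-algebra of bounded sequences in $A$, let $A_\omega := \ell^\infty(A)/\{(a_n) : \lim_{n\to\omega}\|a_n\| = 0\}$, and regard $A$ as a subalgebra of $A_\omega$ via constant sequences. Let $F_\omega(A) := (A_\omega \cap A')/\{x \in A_\omega : xa = ax = 0 \text{ for all } a \in A\}$ be Kirchberg's central sequence algebra. A trace on $A$ is a map $\tau : A_+ \to [0,\infty]$ with $\tau(0)=0$, $\tau(\lambda_1 a_1 + \lambda_2 a_2) = \lambda_1\tau(a_1) + \lambda_2\tau(a_2)$ for $\lambda_i>0$, $a_i \in A_+$, and $\tau(a^*a) = \tau(aa^*)$ for $a \in A$. A generalised limit trace on $A_\omega$ is a trace $\tau$ on $A_\omega$ for which there is a sequence $(\tau_n)$ of lower semicontinuous traces on $A$ with $$\tau((a_n)) = \sup_{\varepsilon>0}\lim_{n\to\omega}\tau_n((a_n-\varepsilon)_+) \quad\text{for all } (a_n) \in \ell^\infty(A)_+ ;$$ the set of these is denoted $\widetilde T_\omega(A)$. For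 $\tau \in \widetilde T_\omega(A)$ and $a \in A_+$ with $\tau(a)<\infty$, the trace $x \mapsto \tau(ax)$ on $A_\omega\cap A'$ induces a trace $\tau_a$ on $F_\omega(A)$. A separable $\mathrm{C}^*$-algebra $A$ has stabilised property $\Gamma$ if for every $n \in \mathbb{N}$ there are pairwise orthogonal positive contractions $e_1,\dots,e_n \in F_\omega(A)$ such that $\tau_a(e_i) = \frac1n\tau(a)$ for all $i=1,\dots,n$, all $a \in A_+$ and all $\tau \in \widetilde T_\omega(A)$ with $\tau(a)<\infty$. Theorem. Let $A$ and $B$ be $\mathrm{C}^*$-algebras with $A\otimes\mathbb{K} \cong B\otimes\mathbb{K}$, where $\mathbb{K}$ is the algebra of compact operators on $\ell^2(\mathbb{N})$. If $A$ is separable and has stabilised property $\Gamma$, then $B$ is separable and has stabilised property $\Gamma$. -/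

import Mathlib

open scoped TensorProduct ENNReal Topology InnerProductSpace
open Filter

noncomputable section

namespace StabilisedGamma

/- ### Compact operators -/

section Compact
variable {H : Type*} [NormedAddCommGroup H] [InnerProductSpace ℂ H] [CompleteSpace H]

/-- The adjoint of a compact operator is compact. -/
theorem isCompactOperator_star (T : H →L[ℂ] H) (hT : IsCompactOperator T) :
    IsCompactOperator (star T : H →L[ℂ] H) := by
  have hS : IsCompactOperator (T ∘L star T) := hT.comp_clm (star T)
  have hS' := (hS.isCompact_closure_image_ball (f := ((T ∘L star T : H →L[ℂ] H) : H →ₗ[ℂ] H)) 1)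
  have tb := hS'.totallyBounded.subset subset_closure
  refine (isCompactOperator_iff_isCompact_closure_image_ball
    ((star T : H →L[ℂ] H) : H →ₗ[ℂ] H) one_pos).2 ?_
  suffices htb : TotallyBounded (⇑(star T : H →L[ℂ] H) '' Metric.ball 0 1) from
    isCompact_iff_totallyBounded_isComplete.2 ⟨htb.closure, isClosed_closure.isComplete⟩
  rw [Metric.totallyBounded_iff]
  intro ε hε
  have hδ : 0 < ε ^ 2 / 2 := by positivity
  obtain ⟨t, ht, htf, htc⟩ := (totallyBounded_iff_subset.1 tb) _ (Metric.dist_mem_uniformity hδ)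
  have ht' : ∀ z ∈ t, ∃ w ∈ Metric.ball (0 : H) 1, T ((star T : H →L[ℂ] H) w) = z := fun z hz => ht hz
  choose! g hg using ht'
  refine ⟨⇑(star T : H →L[ℂ] H) '' (g '' t), (htf.image g).image _, ?_⟩
  rintro _ ⟨y, hy, rfl⟩
  have h1 := htc ⟨y, hy, rfl⟩
  simp only [Set.mem_iUnion, Set.mem_ofPred_eq] at h1
  obtain ⟨z, hz, hd⟩ := h1
  simp only [Set.mem_iUnion]
  refine ⟨(star T : H →L[ℂ] H) (g z), ⟨g z, ⟨z, hz, rfl⟩, rfl⟩, ?_⟩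
  obtain ⟨hg1, hg2⟩ := hg z hz
  rw [← hg2] at hd
  rw [Metric.mem_ball] at hy hg1 ⊢
  rw [dist_zero_right] at hy hg1
  have key : ‖(star T : H →L[ℂ] H) y - (star T : H →L[ℂ] H) (g z)‖ ^ 2 < ε ^ 2 := by
    have e1 : ‖(star T : H →L[ℂ] H) (y - g z)‖ ^ 2 ≤ ‖y - g z‖ * ‖T ((star T : H →L[ℂ] H) (y - g z))‖ := by
      have h2 : ⟪(star T : H →L[ℂ] H) (y - g z), (star T : H →L[ℂ] H) (y - g z)⟫_ℂ = ⟪y - g z, T ((star T : H →L[ℂ] H) (y - g z))⟫_ℂ := by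
        rw [ContinuousLinearMap.star_eq_adjoint, ContinuousLinearMap.adjoint_inner_left]
      have h3 := norm_inner_le_norm (𝕜 := ℂ) (y - g z) (T ((star T : H →L[ℂ] H) (y - g z)))
      rw [← h2, inner_self_eq_norm_sq_to_K] at h3
      simpa using h3
    rw [← map_sub]
    have e2 : ‖y - g z‖ ≤ 2 := (norm_sub_le _ _).trans (by linarith)
    have e3 : ‖T ((star T : H →L[ℂ] H) (y - g z))‖ < ε ^ 2 / 2 := by
      rw [map_sub, map_sub, ← dist_eq_norm]; exact hd
    have e4 := norm_nonneg (T ((star T : H →L[ℂ] H) (y - g z)))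
    nlinarith
  change dist ((star T : H →L[ℂ] H) y) ((star T : H →L[ℂ] H) (g z)) < ε
  rw [dist_eq_norm]
  exact lt_of_pow_lt_pow_left₀ 2 hε.le key

variable (H) in
/-- The C*-algebra of compact operators on a Hilbert space. -/
def compactOps : NonUnitalStarSubalgebra ℂ (H →L[ℂ] H) where
  carrier := {T | IsCompactOperator T}
  add_mem' := fun h₁ h₂ => IsCompactOperator.add h₁ h₂
  zero_mem' := isCompactOperator_zero
  smul_mem' := fun c _ h => IsCompactOperator.smul h c
  mul_mem' := fun {_ b} h _ => IsCompactOperator.comp_clm h b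
  star_mem' := fun {a} h => isCompactOperator_star a h

instance : IsClosed (compactOps H : Set (H →L[ℂ] H)) :=
  isClosed_setOfPred_isCompactOperator

end Compact

/-- The C*-algebra `𝕂` of compact operators on the separable Hilbert space `ℓ²(ℕ)`. -/
abbrev CompactK : Type := compactOps (lp (fun _ : ℕ => ℂ) 2)

/- ### Quotient C*-algebras -/

/-- Closed two-sided self-adjoint ideals of a C*-algebra. -/
structure ClosedIdeal (A : Type*) [NonUnitalCStarAlgebra A] extends Submodule ℂ A where
  mul_mem_left' : ∀ a x : A, x ∈ carrier → a * x ∈ carrier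
  mul_mem_right' : ∀ a x : A, x ∈ carrier → x * a ∈ carrier
  star_mem' : ∀ x : A, x ∈ carrier → star x ∈ carrier
  isClosed' : IsClosed carrier

namespace ClosedIdeal
variable {A : Type*} [NonUnitalCStarAlgebra A] (I : ClosedIdeal A)

/-- The quotient C*-algebra `A / I`, with the quotient norm. -/
def Quot : Type _ := A ⧸ I.toSubmodule

instance : IsClosed (I.toSubmodule : Set A) := I.isClosed'

instance : NormedAddCommGroup I.Quot :=
  inferInstanceAs (NormedAddCommGroup (A ⧸ I.toSubmodule))

instance : NormedSpace ℂ I.Quot :=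
  inferInstanceAs (NormedSpace ℂ (A ⧸ I.toSubmodule))

instance : CompleteSpace I.Quot :=
  inferInstanceAs (CompleteSpace (A ⧸ I.toSubmodule))

/-- The quotient map. -/
def proj : A →ₗ[ℂ] I.Quot := I.toSubmodule.mkQ

theorem proj_surjective : Function.Surjective I.proj := Submodule.mkQ_surjective _

theorem proj_eq_proj {x y : A} : I.proj x = I.proj y ↔ x - y ∈ I.toSubmodule :=
  Submodule.Quotient.eq _

theorem norm_proj_le (x : A) : ‖I.proj x‖ ≤ ‖x‖ := Submodule.Quotient.norm_mk_le _ x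

theorem exists_lift (q : I.Quot) {ε : ℝ} (hε : 0 < ε) : ∃ x, I.proj x = q ∧ ‖x‖ < ‖q‖ + ε :=
  Submodule.Quotient.norm_mk_lt (S := I.toSubmodule) q hε

instance : Mul I.Quot :=
  ⟨Quotient.map₂ (· * ·) (by
    intro a a' ha b b' hb
    rw [← Quotient.eq_iff_equiv] at *
    change I.proj a = I.proj a' at ha
    change I.proj b = I.proj b' at hb
    change I.proj (a * b) = I.proj (a' * b')
    rw [proj_eq_proj] at *
    have : a * b - a' * b' = (a - a') * b + a' * (b - b') := by noncomm_ring
    rw [this]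
    exact add_mem (I.mul_mem_right' _ _ ha) (I.mul_mem_left' _ _ hb))⟩

instance : Star I.Quot :=
  ⟨Quotient.map star (by
    intro a a' ha
    rw [← Quotient.eq_iff_equiv] at *
    change I.proj a = I.proj a' at ha
    change I.proj (star a) = I.proj (star a')
    rw [proj_eq_proj] at *
    rw [← star_sub]
    exact I.star_mem' _ ha)⟩

theorem proj_mul (x y : A) : I.proj (x * y) = I.proj x * I.proj y := rfl
theorem proj_star (x : A) : I.proj (star x) = star (I.proj x) := rfl

instance : NonUnitalRing I.Quot where
  left_distrib := by
    intro a b c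
    obtain ⟨a, rfl⟩ := I.proj_surjective a
    obtain ⟨b, rfl⟩ := I.proj_surjective b
    obtain ⟨c, rfl⟩ := I.proj_surjective c
    simp only [← proj_mul, ← map_add, mul_add]
  right_distrib := by
    intro a b c
    obtain ⟨a, rfl⟩ := I.proj_surjective a
    obtain ⟨b, rfl⟩ := I.proj_surjective b
    obtain ⟨c, rfl⟩ := I.proj_surjective c
    simp only [← proj_mul, ← map_add, add_mul]
  zero_mul := by
    intro a
    obtain ⟨a, rfl⟩ := I.proj_surjective a
    rw [← map_zero I.proj, ← proj_mul, zero_mul]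
  mul_zero := by
    intro a
    obtain ⟨a, rfl⟩ := I.proj_surjective a
    rw [← map_zero I.proj, ← proj_mul, mul_zero]
  mul_assoc := by
    intro a b c
    obtain ⟨a, rfl⟩ := I.proj_surjective a
    obtain ⟨b, rfl⟩ := I.proj_surjective b
    obtain ⟨c, rfl⟩ := I.proj_surjective c
    simp only [← proj_mul, mul_assoc]

instance : NonUnitalNormedRing I.Quot where
  dist_eq := dist_eq_norm_neg_add
  norm_mul_le := by
    intro a b
    refine ge_of_tendsto (x := 𝓝[>] (0 : ℝ)) (f := fun ε => (‖a‖ + ε) * (‖b‖ + ε)) ?_ ?_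
    · have : ContinuousAt (fun ε : ℝ => (‖a‖ + ε) * (‖b‖ + ε)) 0 := by fun_prop
      have h := this.tendsto
      simp only [add_zero] at h
      exact h.mono_left nhdsWithin_le_nhds
    · filter_upwards [self_mem_nhdsWithin] with ε hε
      obtain ⟨x, rfl, hx⟩ := I.exists_lift a hε
      obtain ⟨y, rfl, hy⟩ := I.exists_lift b hε
      rw [← proj_mul]
      refine (I.norm_proj_le _).trans ((norm_mul_le _ _).trans ?_)
      exact mul_le_mul hx.le hy.le (norm_nonneg _) ((norm_nonneg x).trans hx.le)

instance : StarRing I.Quot where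
  star_involutive := by
    intro a
    obtain ⟨a, rfl⟩ := I.proj_surjective a
    rw [← proj_star, ← proj_star, star_star]
  star_mul := by
    intro a b
    obtain ⟨a, rfl⟩ := I.proj_surjective a
    obtain ⟨b, rfl⟩ := I.proj_surjective b
    simp only [← proj_star, ← proj_mul, star_mul]
  star_add := by
    intro a b
    obtain ⟨a, rfl⟩ := I.proj_surjective a
    obtain ⟨b, rfl⟩ := I.proj_surjective b
    simp only [← proj_star, ← map_add, star_add]

instance : StarModule ℂ I.Quot where
  star_smul := by
    intro c a
    obtain ⟨a, rfl⟩ := I.proj_surjective a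
    simp only [← proj_star, ← map_smul, star_smul]

instance : IsScalarTower ℂ I.Quot I.Quot where
  smul_assoc := by
    intro c a b
    obtain ⟨a, rfl⟩ := I.proj_surjective a
    obtain ⟨b, rfl⟩ := I.proj_surjective b
    simp only [← proj_mul, ← map_smul, smul_eq_mul, smul_mul_assoc]

instance : SMulCommClass ℂ I.Quot I.Quot where
  smul_comm := by
    intro c a b
    obtain ⟨a, rfl⟩ := I.proj_surjective a
    obtain ⟨b, rfl⟩ := I.proj_surjective b
    simp only [← proj_mul, ← map_smul, smul_eq_mul, mul_smul_comm]

/-- The ideal as a C*-algebra in its own right. -/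
def toSubalgebra : NonUnitalStarSubalgebra ℂ A where
  carrier := I.carrier
  add_mem' := I.add_mem'
  zero_mem' := I.zero_mem'
  smul_mem' := I.smul_mem'
  mul_mem' := fun {a _} _ h => I.mul_mem_left' a _ h
  star_mem' := fun {a} h => I.star_mem' a h

instance : IsClosed (I.toSubalgebra : Set A) := I.isClosed'

/-- A consequence of the existence of approximate units, used for the C*-identity in `A / I`. -/
theorem exists_approx (j : A) (hj : j ∈ I.toSubmodule) {ε : ℝ} (hε : 0 < ε) :
    ∃ u ∈ I.toSubmodule, ‖j - j * u‖ < ε ∧ (∀ z : A, ‖z - z * u‖ ≤ ‖z‖) ∧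
      (∀ z : A, ‖z - star u * z‖ ≤ ‖z‖) := by
  let : PartialOrder I.toSubalgebra := CStarAlgebra.spectralOrder _
  have : StarOrderedRing I.toSubalgebra := CStarAlgebra.spectralOrderedRing _
  let : PartialOrder A := CStarAlgebra.spectralOrder _
  have : StarOrderedRing A := CStarAlgebra.spectralOrderedRing _
  have hl := CStarAlgebra.increasingApproximateUnit I.toSubalgebra
  have := hl.neBot
  have ht := hl.tendsto_mul_left (⟨j, hj⟩ : I.toSubalgebra)
  have h1 := (Metric.tendsto_nhds.1 ht) ε hε
  obtain ⟨u, hu, hu0, hu1⟩ := (h1.and (hl.eventually_nonneg.and hl.eventually_norm)).exists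
  have hu0' : (0 : A) ≤ (u : A) := by
    obtain ⟨v, hv⟩ := CStarAlgebra.nonneg_iff_eq_star_mul_self.1 hu0
    rw [hv]
    exact star_mul_self_nonneg (v : A)
  have hn : ‖(1 : Unitization ℂ A) - ((u : A) : Unitization ℂ A)‖ ≤ 1 := by
    have h0 : (0 : Unitization ℂ A) ≤ ((u : A) : Unitization ℂ A) :=
      Unitization.inr_nonneg_iff.2 hu0'
    have h2 : ‖((u : A) : Unitization ℂ A)‖ ≤ 1 := by
      rw [Unitization.norm_inr]; exact hu1
    have h3 := (CStarAlgebra.norm_le_one_iff_of_nonneg _ h0).1 h2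
    rw [CStarAlgebra.norm_le_one_iff_of_nonneg _ (sub_nonneg.2 h3)]
    exact sub_le_self _ h0
  have hr : ∀ z : A, ‖z - z * u‖ ≤ ‖z‖ := by
    intro z
    have : ((z - z * u : A) : Unitization ℂ A) =
        (z : Unitization ℂ A) * (1 - ((u : A) : Unitization ℂ A)) := by
      rw [Unitization.inr_sub, Unitization.inr_mul, mul_sub, mul_one]
    rw [← Unitization.norm_inr (𝕜 := ℂ), this]
    refine (norm_mul_le _ _).trans ?_
    rw [Unitization.norm_inr]
    exact mul_le_of_le_one_right (norm_nonneg _) hn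
  refine ⟨u, u.2, ?_, hr, ?_⟩
  · rw [dist_comm, dist_eq_norm] at hu
    exact hu
  · intro z
    have := hr (star z)
    rwa [← norm_star, star_sub, star_mul, star_star, norm_star] at this

instance : CStarRing I.Quot where
  norm_mul_self_le := by
    intro q
    refine le_of_forall_pos_le_add fun ε hε => ?_
    obtain ⟨x, rfl⟩ := I.proj_surjective q
    obtain ⟨y, hy, hyn⟩ := I.exists_lift (star (I.proj x) * I.proj x) (half_pos hε)
    rw [← proj_star, ← proj_mul, proj_eq_proj] at hy
    obtain ⟨u, huI, hju, hr, hl⟩ := I.exists_approx _ hy (half_pos hε)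
    have h1 : I.proj x = I.proj (x - x * u) := by
      rw [proj_eq_proj, sub_sub_cancel]
      exact I.mul_mem_left' _ _ huI
    have h2 : ‖I.proj x‖ * ‖I.proj x‖ ≤ ‖x - x * u‖ * ‖x - x * u‖ := by
      rw [h1]
      gcongr <;> exact I.norm_proj_le _
    refine h2.trans ?_
    rw [← CStarRing.norm_star_mul_self]
    set j := y - star x * x with hj
    have h3 : star (x - x * u) * (x - x * u) =
        ((y - y * u) - star u * (y - y * u)) - ((j - j * u) - star u * (j - j * u)) := by
      rw [hj]
      simp only [star_sub, star_mul]
      noncomm_ring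
    rw [h3]
    refine (norm_sub_le _ _).trans ?_
    have h4 := (hl (y - y * u)).trans (hr y)
    have h5 := hl (j - j * u)
    linarith

instance : NonUnitalCStarAlgebra I.Quot where

end ClosedIdeal

/- ### C*-tensor products -/

section Tensor
variable (A B : Type*) [NonUnitalCStarAlgebra A] [NonUnitalCStarAlgebra B]

/-- The C*-seminorms on the algebraic tensor product `A ⊙ B`. (The bound on elementary tensors is
automatic for a C*-seminorm.) -/
def cstarSeminorms : Set (Seminorm ℂ (A ⊗[ℂ] B)) :=
  {p | (∀ x y, p (x * y) ≤ p x * p y) ∧ (∀ x, p (star x * x) = p x ^ 2) ∧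
    ∀ a b, p (a ⊗ₜ[ℂ] b) ≤ ‖a‖ * ‖b‖}

theorem bddAbove_cstarSeminorms (x : A ⊗[ℂ] B) :
    BddAbove (Set.range fun p : cstarSeminorms A B => (p : Seminorm ℂ (A ⊗[ℂ] B)) x) := by
  induction x using TensorProduct.induction_on with
  | zero => exact ⟨0, by rintro _ ⟨p, rfl⟩; simp⟩
  | tmul a b => exact ⟨‖a‖ * ‖b‖, by rintro _ ⟨p, rfl⟩; exact p.2.2.2 a b⟩
  | add x y hx hy =>
    obtain ⟨C, hC⟩ := hx
    obtain ⟨D, hD⟩ := hy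
    refine ⟨C + D, ?_⟩
    rintro _ ⟨p, rfl⟩
    exact (map_add_le_add (p : Seminorm ℂ (A ⊗[ℂ] B)) x y).trans
      (add_le_add (hC ⟨p, rfl⟩) (hD ⟨p, rfl⟩))

instance : Nonempty (cstarSeminorms A B) :=
  ⟨⟨0, by simp, by simp, fun a b => by simp; positivity⟩⟩

variable {A B} in
/-- The maximal C*-norm on `A ⊙ B`. -/
def maxNorm (x : A ⊗[ℂ] B) : ℝ := ⨆ p : cstarSeminorms A B, (p : Seminorm ℂ (A ⊗[ℂ] B)) x

variable {A B}

theorem le_maxNorm (p : cstarSeminorms A B) (x : A ⊗[ℂ] B) :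
    (p : Seminorm ℂ (A ⊗[ℂ] B)) x ≤ maxNorm x :=
  le_ciSup (bddAbove_cstarSeminorms A B x) p

theorem maxNorm_le {x : A ⊗[ℂ] B} {C : ℝ}
    (h : ∀ p : cstarSeminorms A B, (p : Seminorm ℂ (A ⊗[ℂ] B)) x ≤ C) : maxNorm x ≤ C :=
  ciSup_le h

theorem maxNorm_nonneg (x : A ⊗[ℂ] B) : 0 ≤ maxNorm x :=
  (apply_nonneg _ _).trans (le_maxNorm (Classical.arbitrary _) x)

theorem maxNorm_mul_le (x y : A ⊗[ℂ] B) : maxNorm (x * y) ≤ maxNorm x * maxNorm y :=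
  maxNorm_le fun p => (p.2.1 x y).trans
    (mul_le_mul (le_maxNorm p x) (le_maxNorm p y) (apply_nonneg _ _) (maxNorm_nonneg x))

theorem maxNorm_sq_le (x : A ⊗[ℂ] B) : maxNorm x * maxNorm x ≤ maxNorm (star x * x) := by
  rw [← sq]
  refine (Real.le_sqrt (maxNorm_nonneg x) (maxNorm_nonneg _)).1 (maxNorm_le fun p => ?_)
  refine Real.le_sqrt_of_sq_le ?_
  rw [← p.2.2.1 x]
  exact le_maxNorm p _

variable (A B)

/-- The algebraic tensor product, to be normed by the maximal C*-norm. -/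
def AlgTensor : Type _ := A ⊗[ℂ] B

namespace AlgTensor

instance : AddCommGroup (AlgTensor A B) := inferInstanceAs (AddCommGroup (A ⊗[ℂ] B))
instance : NonUnitalRing (AlgTensor A B) := inferInstanceAs (NonUnitalRing (A ⊗[ℂ] B))
instance : StarRing (AlgTensor A B) := inferInstanceAs (StarRing (A ⊗[ℂ] B))
instance : Module ℂ (AlgTensor A B) := inferInstanceAs (Module ℂ (A ⊗[ℂ] B))
instance : StarModule ℂ (AlgTensor A B) := inferInstanceAs (StarModule ℂ (A ⊗[ℂ] B))
instance : IsScalarTower ℂ (AlgTensor A B) (AlgTensor A B) :=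
  inferInstanceAs (IsScalarTower ℂ (A ⊗[ℂ] B) (A ⊗[ℂ] B))
instance : SMulCommClass ℂ (AlgTensor A B) (AlgTensor A B) :=
  inferInstanceAs (SMulCommClass ℂ (A ⊗[ℂ] B) (A ⊗[ℂ] B))

instance : SeminormedAddCommGroup (AlgTensor A B) :=
  AddGroupSeminorm.toSeminormedAddCommGroup
    { toFun := fun x => maxNorm (A := A) (B := B) x
      map_zero' := le_antisymm (maxNorm_le fun _ => (map_zero _).le) (maxNorm_nonneg _)
      add_le' := fun _ _ => maxNorm_le fun p => (map_add_le_add _ _ _).trans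
        (add_le_add (le_maxNorm p _) (le_maxNorm p _))
      neg' := fun _ => congrArg iSup (funext fun _ => map_neg_eq_map _ _) }

theorem norm_def (x : AlgTensor A B) : ‖x‖ = maxNorm (A := A) (B := B) x := rfl

instance : NonUnitalSeminormedRing (AlgTensor A B) where
  dist_eq := dist_eq_norm_neg_add
  norm_mul_le := maxNorm_mul_le

instance : NormedSpace ℂ (AlgTensor A B) where
  norm_smul_le := fun c x => maxNorm_le fun p => by
    refine (map_smul_eq_mul (p : Seminorm ℂ (A ⊗[ℂ] B)) c x).le.trans ?_
    exact mul_le_mul_of_nonneg_left (le_maxNorm p _) (norm_nonneg c)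

variable {A B} in
theorem norm_sq_le (x : AlgTensor A B) : ‖x‖ * ‖x‖ ≤ ‖star x * x‖ := maxNorm_sq_le x

instance : NormedStarGroup (AlgTensor A B) where
  norm_star_le := by
    intro x
    rcases (norm_nonneg (star x)).eq_or_lt with h | h
    · rw [← h]
      exact norm_nonneg x
    · refine le_of_mul_le_mul_right ?_ h
      have := (norm_sq_le (star x)).trans (norm_mul_le _ _)
      rwa [star_star] at this

end AlgTensor

open UniformSpace

/-- The (maximal) C*-tensor product `A ⊗ B`: the completion of the algebraic tensor product in the
maximal C*-norm. When `A` or `B` is nuclear, e.g. `B = 𝕂`, there is only one C*-norm on the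
algebraic tensor product, so this is *the* C*-tensor product. -/
def MaxTensor : Type _ := Completion (AlgTensor A B)

namespace MaxTensor

instance : NormedAddCommGroup (MaxTensor A B) :=
  inferInstanceAs (NormedAddCommGroup (Completion (AlgTensor A B)))
instance : NormedSpace ℂ (MaxTensor A B) :=
  inferInstanceAs (NormedSpace ℂ (Completion (AlgTensor A B)))
instance : CompleteSpace (MaxTensor A B) :=
  inferInstanceAs (CompleteSpace (Completion (AlgTensor A B)))

variable {A B}

/-- The canonical map from the algebraic tensor product. -/
def ofAlg : AlgTensor A B →L[ℂ] MaxTensor A B := Completion.toComplL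

theorem norm_ofAlg (x : AlgTensor A B) : ‖ofAlg x‖ = ‖x‖ := Completion.norm_coe x

theorem isDenseInducing_ofAlg : IsDenseInducing (ofAlg : AlgTensor A B → MaxTensor A B) :=
  Completion.isDenseInducing_coe

theorem denseRange_ofAlg : DenseRange (ofAlg : AlgTensor A B → MaxTensor A B) :=
  Completion.denseRange_coe

instance : Mul (MaxTensor A B) :=
  ⟨fun x y => (isDenseInducing_ofAlg.prodMap isDenseInducing_ofAlg).extend
    (fun p : AlgTensor A B × AlgTensor A B => ofAlg (p.1 * p.2)) (x, y)⟩

instance : Star (MaxTensor A B) :=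
  ⟨fun x => Completion.map (star : AlgTensor A B → AlgTensor A B) x⟩

theorem ofAlg_mul (x y : AlgTensor A B) : ofAlg (x * y) = ofAlg x * ofAlg y :=
  ((isDenseInducing_ofAlg.prodMap isDenseInducing_ofAlg).extend_eq
    (ofAlg.continuous.comp continuous_mul) (x, y)).symm

theorem ofAlg_star (x : AlgTensor A B) : ofAlg (star x) = star (ofAlg x) :=
  (Completion.map_coe star_isometry.uniformContinuous x).symm

instance : ContinuousMul (MaxTensor A B) where
  continuous_mul := by
    let m := (AddMonoidHom.mul : AlgTensor A B →+ AlgTensor A B →+ AlgTensor A B).compr₂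
      (ofAlg : AlgTensor A B →L[ℂ] MaxTensor A B).toLinearMap.toAddMonoidHom
    have h : Continuous fun p : AlgTensor A B × AlgTensor A B => m p.1 p.2 :=
      ofAlg.continuous.comp continuous_mul
    have di : IsDenseInducing
      ((ofAlg : AlgTensor A B →L[ℂ] MaxTensor A B).toLinearMap.toAddMonoidHom) :=
      isDenseInducing_ofAlg
    exact di.extend_Z_bilin di h

instance : ContinuousStar (MaxTensor A B) where
  continuous_star := by
    exact Completion.continuous_map (f := (star : AlgTensor A B → AlgTensor A B))

@[elab_as_elim]
theorem ind₁ {p : MaxTensor A B → Prop} (a : MaxTensor A B) (hp : IsClosed {a | p a})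
    (h : ∀ x, p (ofAlg x)) : p a :=
  Completion.induction_on a hp h

@[elab_as_elim]
theorem ind₂ {p : MaxTensor A B → MaxTensor A B → Prop} (a b : MaxTensor A B)
    (hp : IsClosed {x : MaxTensor A B × MaxTensor A B | p x.1 x.2})
    (h : ∀ x y, p (ofAlg x) (ofAlg y)) : p a b :=
  Completion.induction_on₂ a b hp h

@[elab_as_elim]
theorem ind₃ {p : MaxTensor A B → MaxTensor A B → MaxTensor A B → Prop} (a b c : MaxTensor A B)
    (hp : IsClosed {x : MaxTensor A B × MaxTensor A B × MaxTensor A B | p x.1 x.2.1 x.2.2})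
    (h : ∀ x y z, p (ofAlg x) (ofAlg y) (ofAlg z)) : p a b c :=
  Completion.induction_on₃ a b c hp h

instance : NonUnitalRing (MaxTensor A B) where
  left_distrib a b c := ind₃ a b c (isClosed_eq (by fun_prop) (by fun_prop)) fun x y z => by
    simp only [← ofAlg_mul, ← map_add, mul_add]
  right_distrib a b c := ind₃ a b c (isClosed_eq (by fun_prop) (by fun_prop)) fun x y z => by
    simp only [← ofAlg_mul, ← map_add, add_mul]
  zero_mul a := ind₁ a (isClosed_eq (by fun_prop) (by fun_prop)) fun x => by
    rw [← map_zero ofAlg, ← ofAlg_mul, zero_mul]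
  mul_zero a := ind₁ a (isClosed_eq (by fun_prop) (by fun_prop)) fun x => by
    rw [← map_zero ofAlg, ← ofAlg_mul, mul_zero]
  mul_assoc a b c := ind₃ a b c (isClosed_eq (by fun_prop) (by fun_prop)) fun x y z => by
    simp only [← ofAlg_mul, mul_assoc]

instance : NonUnitalNormedRing (MaxTensor A B) where
  dist_eq := dist_eq_norm_neg_add
  norm_mul_le a b := ind₂ a b (isClosed_le (by fun_prop) (by fun_prop)) fun x y => by
    simp only [← ofAlg_mul, norm_ofAlg]
    exact norm_mul_le x y

instance : StarRing (MaxTensor A B) where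
  star_involutive a := ind₁ a (isClosed_eq (by fun_prop) (by fun_prop)) fun x => by
    simp only [← ofAlg_star, star_star]
  star_mul a b := ind₂ a b (isClosed_eq (by fun_prop) (by fun_prop)) fun x y => by
    simp only [← ofAlg_star, ← ofAlg_mul, star_mul]
  star_add a b := ind₂ a b (isClosed_eq (by fun_prop) (by fun_prop)) fun x y => by
    simp only [← ofAlg_star, ← map_add, star_add]

instance : CStarRing (MaxTensor A B) where
  norm_mul_self_le a := ind₁ a (isClosed_le (by fun_prop) (by fun_prop)) fun x => by
    simp only [← ofAlg_star, ← ofAlg_mul, norm_ofAlg]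
    exact AlgTensor.norm_sq_le x

instance : StarModule ℂ (MaxTensor A B) where
  star_smul := by
    intro c a
    induction a using ind₁ with
    | hp =>
      have h₁ : Continuous fun a : MaxTensor A B => star (c • a) :=
        continuous_star.comp (continuous_id.const_smul c)
      have h₂ : Continuous fun a : MaxTensor A B => star c • star a :=
        continuous_star.const_smul (star c)
      exact isClosed_eq h₁ h₂
    | h x => simp only [← ofAlg_star, ← map_smul, star_smul]

instance : IsScalarTower ℂ (MaxTensor A B) (MaxTensor A B) where
  smul_assoc := by
    intro c a b
    simp only [smul_eq_mul]
    induction a, b using ind₂ with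
    | hp =>
      have h₁ : Continuous fun p : MaxTensor A B × MaxTensor A B => (c • p.1) * p.2 :=
        (continuous_fst.const_smul c).mul continuous_snd
      have h₂ : Continuous fun p : MaxTensor A B × MaxTensor A B => c • (p.1 * p.2) :=
        continuous_mul.const_smul c
      exact isClosed_eq h₁ h₂
    | h x y => simp only [← ofAlg_mul, ← map_smul, smul_mul_assoc]

instance : SMulCommClass ℂ (MaxTensor A B) (MaxTensor A B) where
  smul_comm := by
    intro c a b
    simp only [smul_eq_mul]
    induction a, b using ind₂ with
    | hp =>
      have h₁ : Continuous fun p : MaxTensor A B × MaxTensor A B => c • (p.1 * p.2) :=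
        continuous_mul.const_smul c
      have h₂ : Continuous fun p : MaxTensor A B × MaxTensor A B => p.1 * (c • p.2) :=
        continuous_fst.mul (continuous_snd.const_smul c)
      exact isClosed_eq h₁ h₂
    | h x y => simp only [← ofAlg_mul, ← map_smul, mul_smul_comm]

instance : NonUnitalCStarAlgebra (MaxTensor A B) where

end MaxTensor
end Tensor

/-- The stabilisation `A ⊗ 𝕂`. -/
abbrev Stabilisation (A : Type*) [NonUnitalCStarAlgebra A] : Type _ := MaxTensor A CompactK

/-- `A` and `B` are stably isomorphic: `A ⊗ 𝕂 ≅ B ⊗ 𝕂` as C*-algebras. -/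
def StablyIsomorphic (A B : Type*) [NonUnitalCStarAlgebra A] [NonUnitalCStarAlgebra B] : Prop :=
  Nonempty (Stabilisation A ≃⋆ₐ[ℂ] Stabilisation B)

/- ### Positive elements and traces -/

/-- Positive elements of a C*-algebra. -/
def IsPos {A : Type*} [NonUnitalCStarAlgebra A] (a : A) : Prop := ∃ b : A, a = star b * b

/-- (Extended) traces `τ : A₊ → [0, ∞]`. For convenience `τ` is a function on all of `A`; only its
values on positive elements are ever used. -/
structure IsTrace {A : Type*} [NonUnitalCStarAlgebra A] (τ : A → ℝ≥0∞) : Prop where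
  map_zero : τ 0 = 0
  map_combination : ∀ (s t : ℝ) (a b : A), 0 < s → 0 < t → IsPos a → IsPos b →
    τ ((s : ℂ) • a + (t : ℂ) • b) = ENNReal.ofReal s * τ a + ENNReal.ofReal t * τ b
  map_star_mul_self : ∀ a : A, τ (star a * a) = τ (a * star a)

/-- Lower semicontinuous (extended) traces on `A₊`. -/
structure IsLscTrace {A : Type*} [NonUnitalCStarAlgebra A] (τ : A → ℝ≥0∞) : Prop
    extends IsTrace τ where
  lowerSemicontinuousOn : LowerSemicontinuousOn τ {a | IsPos a}

/-- The cut-down `(a - ε)₊`, by functional calculus. -/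
def cutDown {A : Type*} [NonUnitalCStarAlgebra A] (ε : ℝ) (a : A) : A :=
  cfcₙ (fun t : ℝ => max (t - ε) 0) a

/- ### Ultrapowers and Kirchberg's central sequence algebra -/

/-- The C*-algebra `ℓ^∞(A)` of bounded sequences in `A`. -/
abbrev BddSeq (A : Type*) [NonUnitalCStarAlgebra A] : Type _ := lp (fun _ : ℕ => A) ∞

section Ultrapower
variable (ω : Ultrafilter ℕ) (A : Type*) [NonUnitalCStarAlgebra A]

/-- The ideal of bounded sequences with `lim_{n → ω} ‖x n‖ = 0`. -/
def nullIdeal : ClosedIdeal (BddSeq A) where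
  carrier := {x | Tendsto (fun n => ‖x n‖) ω (𝓝 0)}
  add_mem' := by
    intro x y hx hy
    have h := Tendsto.add (M := ℝ) hx hy
    rw [add_zero] at h
    exact squeeze_zero (fun n => norm_nonneg _) (fun n => norm_add_le (x n) (y n)) h
  zero_mem' := by
    simp
  smul_mem' := by
    intro c x hx
    have h := Tendsto.const_mul (M := ℝ) ‖c‖ hx
    rw [mul_zero] at h
    exact squeeze_zero (fun n => norm_nonneg _) (fun n => norm_smul_le c (x n)) h
  mul_mem_left' := by
    intro a x hx
    have h := Tendsto.const_mul (M := ℝ) ‖a‖ hx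
    rw [mul_zero] at h
    refine squeeze_zero (fun n => norm_nonneg _) (fun n => ?_) h
    refine (norm_mul_le (a n) (x n)).trans ?_
    gcongr
    exact lp.norm_apply_le_norm ENNReal.top_ne_zero a n
  mul_mem_right' := by
    intro a x hx
    have h := Tendsto.mul_const (M := ℝ) ‖a‖ hx
    rw [zero_mul] at h
    refine squeeze_zero (fun n => norm_nonneg _) (fun n => ?_) h
    refine (norm_mul_le (x n) (a n)).trans ?_
    gcongr
    exact lp.norm_apply_le_norm ENNReal.top_ne_zero a n
  star_mem' := by
    intro x hx
    exact Tendsto.congr (fun n => (norm_star (x n)).symm) hx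
  isClosed' := by
    refine isClosed_of_closure_subset fun x hx => ?_
    refine Metric.tendsto_nhds.2 fun ε hε => ?_
    obtain ⟨y, hy, hxy⟩ := Metric.mem_closure_iff.1 hx (ε / 2) (half_pos hε)
    filter_upwards [(Metric.tendsto_nhds.1 hy) (ε / 2) (half_pos hε)] with n hn
    rw [dist_eq_norm] at hxy
    have h1 : ‖x n - y n‖ ≤ ‖x - y‖ := lp.norm_apply_le_norm ENNReal.top_ne_zero (x - y) n
    have h2 : ‖x n‖ ≤ ‖x n - y n‖ + ‖y n‖ := by
      simpa using norm_add_le (x n - y n) (y n)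
    simp only [dist_zero_right, norm_norm] at hn ⊢
    linarith

/-- The ultrapower `A_ω`. -/
abbrev Ultrapower : Type _ := (nullIdeal ω A).Quot

variable {A} in
/-- The constant sequence with value `a`. -/
def constSeq (a : A) : BddSeq A :=
  ⟨fun _ => a, memℓp_infty ⟨‖a‖, by rintro _ ⟨n, rfl⟩; exact le_rfl⟩⟩

variable {A} in
/-- The canonical embedding of `A` in `A_ω` by constant sequences. -/
def diag (a : A) : Ultrapower ω A := (nullIdeal ω A).proj (constSeq a)

/-- The relative commutant `A_ω ∩ A'`. -/
abbrev RelCommutant : NonUnitalStarSubalgebra ℂ (Ultrapower ω A) :=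
  NonUnitalStarSubalgebra.centralizer ℂ (Set.range (diag ω (A := A)))

instance : IsClosed (RelCommutant ω A : Set (Ultrapower ω A)) := by
  rw [NonUnitalStarSubalgebra.coe_centralizer]
  exact Set.isClosed_centralizer _

/-- The annihilator `Ann(A)` of `A` in `A_ω`. It is contained in `A_ω ∩ A'`, and regarded as an
ideal of the latter. -/
def annIdeal : ClosedIdeal (RelCommutant ω A) where
  carrier := {x | ∀ a : A, (x : Ultrapower ω A) * diag ω a = 0 ∧ diag ω a * (x : Ultrapower ω A) = 0}
  add_mem' := by
    intro x y hx hy a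
    simp [add_mul, mul_add, hx a, hy a]
  zero_mem' := by
    intro a
    simp
  smul_mem' := by
    intro c x hx a
    simp [smul_mul_assoc, mul_smul_comm, hx a]
  mul_mem_left' := by
    intro y x hx a
    have hc : diag ω a * (y : Ultrapower ω A) = y * diag ω a :=
      y.2 (diag ω a) (Or.inl ⟨a, rfl⟩)
    simp only [MulMemClass.coe_mul]
    constructor
    · rw [mul_assoc, (hx a).1, mul_zero]
    · rw [← mul_assoc, hc, mul_assoc, (hx a).2, mul_zero]
  mul_mem_right' := by
    intro y x hx a
    have hc : diag ω a * (y : Ultrapower ω A) = y * diag ω a :=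
      y.2 (diag ω a) (Or.inl ⟨a, rfl⟩)
    simp only [MulMemClass.coe_mul]
    constructor
    · rw [mul_assoc, ← hc, ← mul_assoc, (hx a).1, zero_mul]
    · rw [← mul_assoc, (hx a).2, zero_mul]
  star_mem' := by
    intro x hx a
    have hs : star (diag ω (star a)) = diag ω a := by
      rw [diag, ← ClosedIdeal.proj_star]
      congr 1
      ext n
      exact star_star a
    constructor
    · have h := congrArg star (hx (star a)).2
      rw [star_mul, hs, star_zero] at h
      exact h
    · have h := congrArg star (hx (star a)).1
      rw [star_mul, hs, star_zero] at h
      exact h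
  isClosed' := by
    simp only [Set.ofPred_forall, Set.ofPred_and]
    refine isClosed_iInter fun a => IsClosed.inter ?_ ?_
    · have h : Continuous fun x : RelCommutant ω A => (x : Ultrapower ω A) * diag ω a :=
        continuous_subtype_val.mul continuous_const
      exact isClosed_eq h continuous_const
    · have h : Continuous fun x : RelCommutant ω A => diag ω a * (x : Ultrapower ω A) :=
        (continuous_const (y := diag ω a)).mul continuous_subtype_val
      exact isClosed_eq h continuous_const

/-- Kirchberg's central sequence algebra `F_ω(A) = (A_ω ∩ A') / Ann(A)`. -/
abbrev CentralSeqAlgebra : Type _ := (annIdeal ω A).Quot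

variable {A}

/-- The generalised limit traces on `A_ω`: the traces induced by some
`(x_n) ↦ sup_{ε > 0} lim_{n → ω} τ_n((x_n - ε)₊)` on the positive bounded sequences, where the
`τ_n` are lower semicontinuous traces on `A`. (The limit exists since `[0, ∞]` is compact.) -/
def IsGeneralisedLimitTrace (σ : Ultrapower ω A → ℝ≥0∞) : Prop :=
  IsTrace σ ∧ ∃ τ : ℕ → A → ℝ≥0∞, (∀ n, IsLscTrace (τ n)) ∧
    ∀ x : BddSeq A, IsPos x → σ ((nullIdeal ω A).proj x) =
      ⨆ (ε : ℝ) (_ : 0 < ε), limUnder (ω : Filter ℕ) fun n => τ n (cutDown ε (x n))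

/-- The trace `τ_a : x ↦ τ(a x)` on the positive cone of `A_ω ∩ A'`. -/
def twist (τ : Ultrapower ω A → ℝ≥0∞) (a : A) (x : RelCommutant ω A) : ℝ≥0∞ :=
  τ (diag ω a * (x : Ultrapower ω A))

variable (A)

/-- Stabilised property `Γ` of a separable C*-algebra. The trace on `F_ω(A)` induced by
`τ_a : (A_ω ∩ A')₊ → [0, ∞]` is evaluated at the positive element `e i` by evaluating `τ_a` at the
positive lifts of `e i` to `A_ω ∩ A'`. -/
def HasStabilisedPropertyGamma : Prop :=
  TopologicalSpace.SeparableSpace A ∧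
  ∀ n : ℕ, ∃ e : Fin n → CentralSeqAlgebra ω A,
    (∀ i, IsPos (e i)) ∧ (∀ i, ‖e i‖ ≤ 1) ∧ (∀ i j, i ≠ j → e i * e j = 0) ∧
    ∀ (a : A) (τ : Ultrapower ω A → ℝ≥0∞), IsPos a → IsGeneralisedLimitTrace ω τ →
      τ (diag ω a) < ∞ → ∀ i, ∀ x : RelCommutant ω A, IsPos x → (annIdeal ω A).proj x = e i →
        twist ω τ a x = (n : ℝ≥0∞)⁻¹ * τ (diag ω a)

end Ultrapower

end StabilisedGamma

end

/-!
Both `A ⊗ 𝕂` and, through the isomorphism, `B ⊗ 𝕂` can be regarded as one algebra `E` which is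
densely spanned by matrix units with coefficients in `A`, and also by matrix units with coefficients in
`B`. Such a presentation of `E` over `B` is a `MatrixSystem B E`, written `ι i j b` for
`b ⊗ e_{ij}`. It therefore suffices to show, for a matrix system over `B`, that `B` has stabilised
property `Γ` if and only if `E` has it: `hasStabilisedPropertyGamma_right` and
`hasStabilisedPropertyGamma_left`.

*Central sequences.* Say that `x ∈ B_ω ∩ B'` and `y ∈ E_ω ∩ E'` are related if `y` acts on the
corner `B ⊗ e_{00}` as `x ⊗ e_{00}`. Every `x = (x_n)` is related to the class of
`(x_n ⊗ (e_{00} + ⋯ + e_{n-1,n-1}))`, every `y = (y_n)` to the class of the `(0, 0)`-entries of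
the `y_n`, and related elements annihilate the respective algebra simultaneously. So the relation
induces `*`-homomorphisms between `F_ω(B)` and `F_ω(E)` in both directions, which carry the
elements `e_1, …, e_n` over.

*From `B` to `E`.* A generalised limit trace on `E_ω` restricts to one on `B_ω`, so the trace
identity is known for elements `b ⊗ e_{00}`. An arbitrary positive `c = r* r` is a limit from
below of elements `r* (u ⊗ (e_{00} + ⋯ + e_{m-1,m-1})) r`, with `u` in an approximate unit of `B`,
and the summands `r* (u ⊗ e_{kk}) r` of the latter are equivalent, in the sense `v* v ∼ v v*`, to
elements of the corner. As generalised limit traces are lower semicontinuous, the identity passes to `c`: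
`trace_diag_mul_eq`.

*From `E` to `B`.* A lower semicontinuous trace on `B` extends to `E` by summing over the diagonal
entries (`isLscTrace_extendTrace`). Applying this to every member of a sequence of traces gives a
generalised limit trace on `E_ω` which extends the given one. This uses that every sequence of
lower semicontinuous traces defines a trace on the ultrapower
(`exists_isGeneralisedLimitTrace`), which rests on inequalities for traces of the cut-downs of
`a + b` and of `z z*`.

*The stabilisation.* Two of the matrix system axioms for `B ⊗ 𝕂` are not formal. The elements
`b ⊗ e_{ij}` have dense span since compact operators are limits of their corners. The other is that
`b ↦ b ⊗ e_{00}` is injective, in other words that the maximal C*-seminorm does not vanish on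
`b ⊗ e_{00}`. The limit of the norms of the upper left `n × n` corners is a C*-seminorm on
`B ⊙ 𝕂` which dominates `‖b‖` there (`exists_cornerSeminorm`).
-/

noncomputable section

namespace StabilisedGamma

/-! ### Positive elements and cut-downs -/

section Positive
variable {A B : Type*} [NonUnitalCStarAlgebra A] [NonUnitalCStarAlgebra B]

theorem isPos_iff_nonneg [PartialOrder A] [StarOrderedRing A] {a : A} : IsPos a ↔ 0 ≤ a :=
  CStarAlgebra.nonneg_iff_eq_star_mul_self.symm

theorem isPos_star_mul_self (a : A) : IsPos (star a * a) := ⟨a, rfl⟩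

theorem isPos_mul_star_self (a : A) : IsPos (a * star a) := ⟨star a, by rw [star_star]⟩

theorem isPos_zero : IsPos (0 : A) := ⟨0, by simp⟩

namespace IsPos

theorem isSelfAdjoint {a : A} (ha : IsPos a) : IsSelfAdjoint a := by
  obtain ⟨b, rfl⟩ := ha
  exact IsSelfAdjoint.star_mul_self b

theorem add {a b : A} (ha : IsPos a) (hb : IsPos b) : IsPos (a + b) := by
  let : PartialOrder A := CStarAlgebra.spectralOrder _
  have : StarOrderedRing A := CStarAlgebra.spectralOrderedRing _
  rw [isPos_iff_nonneg] at *
  exact add_nonneg ha hb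

theorem sum {ι : Type*} {s : Finset ι} {f : ι → A} (h : ∀ i ∈ s, IsPos (f i)) :
    IsPos (∑ i ∈ s, f i) :=
  Finset.sum_induction f IsPos (fun _ _ => add) isPos_zero h

theorem smul {a : A} (ha : IsPos a) {c : ℝ} (hc : 0 ≤ c) : IsPos ((c : ℂ) • a) := by
  obtain ⟨b, rfl⟩ := ha
  refine ⟨((√c : ℝ) : ℂ) • b, ?_⟩
  rw [star_smul, smul_mul_smul_comm, Complex.star_def, Complex.conj_ofReal, ← Complex.ofReal_mul,
    Real.mul_self_sqrt hc]

theorem star_left_conjugate {a : A} (ha : IsPos a) (g : A) : IsPos (star g * a * g) := by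
  obtain ⟨b, rfl⟩ := ha
  exact ⟨b * g, by simp only [star_mul, mul_assoc]⟩

theorem map {F : Type*} [FunLike F A B] [NonUnitalAlgHomClass F ℂ A B] [StarHomClass F A B]
    {a : A} (ha : IsPos a) (φ : F) : IsPos (φ a) := by
  obtain ⟨b, rfl⟩ := ha
  exact ⟨φ b, by rw [map_mul, map_star]⟩

theorem exists_sqrt {a : A} (ha : IsPos a) : ∃ s : A, star s = s ∧ s * s = a := by
  let : PartialOrder A := CStarAlgebra.spectralOrder _
  have : StarOrderedRing A := CStarAlgebra.spectralOrderedRing _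
  rw [isPos_iff_nonneg] at ha
  exact ⟨CFC.sqrt a, (IsSelfAdjoint.of_nonneg (CFC.sqrt_nonneg a)).star_eq,
    CFC.sqrt_mul_sqrt_self a ha⟩

theorem norm_le {a b : A} (ha : IsPos a) (hab : IsPos (b - a)) : ‖a‖ ≤ ‖b‖ := by
  let : PartialOrder A := CStarAlgebra.spectralOrder _
  have : StarOrderedRing A := CStarAlgebra.spectralOrderedRing _
  rw [isPos_iff_nonneg] at *
  exact CStarAlgebra.norm_le_norm_of_nonneg_of_le ha (sub_nonneg.1 hab)

end IsPos

theorem isClosed_isPos : IsClosed {a : A | IsPos a} := by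
  let : PartialOrder A := CStarAlgebra.spectralOrder _
  have : StarOrderedRing A := CStarAlgebra.spectralOrderedRing _
  simp only [isPos_iff_nonneg]
  exact CStarAlgebra.isClosed_nonneg

/-- `g* b g ≤ c g* g` for selfadjoint `b` with `‖b‖ ≤ c`. This replaces `b ≤ ‖b‖`, which needs a
unit. -/
theorem isPos_norm_smul_sub_conjugate {b : A} (hb : IsSelfAdjoint b) {c : ℝ} (hc : ‖b‖ ≤ c)
    (g : A) : IsPos ((c : ℂ) • (star g * g) - star g * b * g) := by
  let : PartialOrder A := CStarAlgebra.spectralOrder _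
  have : StarOrderedRing A := CStarAlgebra.spectralOrderedRing _
  have h := CStarAlgebra.star_left_conjugate_le_norm_smul (a := g) (b := b) hb
  have h1 := ((isPos_star_mul_self g).smul (sub_nonneg.2 hc)).add
    (isPos_iff_nonneg.2 (sub_nonneg.2 h))
  convert h1 using 1
  push_cast
  rw [sub_smul, ← Complex.coe_smul ‖b‖ (star g * g)]
  abel

/-- `z g g* z* ≤ z z*` for a contraction `g`. -/
theorem isPos_mul_star_sub {z g : A} (hg : ‖g‖ ≤ 1) :
    IsPos (z * star z - z * (g * star g) * star z) := by
  have h : ‖g * star g‖ ≤ 1 := by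
    rw [CStarRing.norm_self_mul_star]
    nlinarith [norm_nonneg g]
  have := isPos_norm_smul_sub_conjugate (IsSelfAdjoint.mul_star_self g) h (star z)
  simpa using this

section cfc
variable {a : A} {f : ℝ → ℝ}

theorem quasispectrum_nonneg (ha : IsPos a) {t : ℝ} (ht : t ∈ quasispectrum ℝ a) : 0 ≤ t := by
  let : PartialOrder A := CStarAlgebra.spectralOrder _
  have : StarOrderedRing A := CStarAlgebra.spectralOrderedRing _
  rw [isPos_iff_nonneg] at ha
  exact quasispectrum_nonneg_of_nonneg a ha t ht

theorem isPos_cfcₙ (h : ∀ t ∈ quasispectrum ℝ a, 0 ≤ f t) : IsPos (cfcₙ f a) := by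
  let : PartialOrder A := CStarAlgebra.spectralOrder _
  have : StarOrderedRing A := CStarAlgebra.spectralOrderedRing _
  rw [isPos_iff_nonneg]
  exact cfcₙ_nonneg h

end cfc

theorem isPos_cutDown (ε : ℝ) (a : A) : IsPos (cutDown ε a) :=
  isPos_cfcₙ fun _ _ => le_max_right _ _

theorem isPos_sub_cutDown {a : A} (ha : IsPos a) {ε : ℝ} (hε : 0 ≤ ε) :
    IsPos (a - cutDown ε a) := by
  have h0 : max (0 - ε) 0 = 0 := by simp [hε]
  have hs := ha.isSelfAdjoint
  rw [cutDown]
  nth_rw 1 [← cfcₙ_id' ℝ a]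
  rw [← cfcₙ_sub _ _ a]
  refine isPos_cfcₙ fun t ht => ?_
  have := quasispectrum_nonneg ha ht
  rw [sub_nonneg, max_le_iff]
  exact ⟨by linarith, this⟩

theorem norm_sub_cutDown_le {a : A} (ha : IsPos a) {ε : ℝ} (hε : 0 ≤ ε) :
    ‖a - cutDown ε a‖ ≤ ε := by
  have h0 : max (0 - ε) 0 = 0 := by simp [hε]
  have hs := ha.isSelfAdjoint
  rw [cutDown]
  nth_rw 1 [← cfcₙ_id' ℝ a]
  rw [← cfcₙ_sub _ _ a]
  refine norm_cfcₙ_le fun t ht => ?_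
  have := quasispectrum_nonneg ha ht
  rw [Real.norm_eq_abs, abs_le]
  rcases max_cases (t - ε) 0 with h | h <;> constructor <;> linarith

theorem cutDown_cutDown {a : A} (ha : IsPos a) {ε δ : ℝ} (hε : 0 ≤ ε) (hδ : 0 ≤ δ) :
    cutDown δ (cutDown ε a) = cutDown (ε + δ) a := by
  have h0 : max (0 - ε) 0 = 0 := by simp [hε]
  have h0' : max (0 - δ) 0 = 0 := by simp [hδ]
  have hs := ha.isSelfAdjoint
  rw [cutDown, cutDown, ← cfcₙ_comp' _ _ a, cutDown]
  refine cfcₙ_congr fun t _ => ?_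
  rcases max_cases (t - ε) 0 with h | h <;> rw [h.1] <;> simp only [sub_add_eq_sub_sub]
  rw [max_eq_right (by linarith), max_eq_right (by linarith)]

theorem cutDown_smul {a : A} (ha : IsPos a) {ε s : ℝ} (hε : 0 ≤ ε) (hs : 0 < s) :
    cutDown (s * ε) ((s : ℂ) • a) = (s : ℂ) • cutDown ε a := by
  have h0 : max (0 - ε) 0 = 0 := by simp [hε]
  have h0' : max (0 - s * ε) 0 = 0 := by simp; positivity
  have hs' := ha.isSelfAdjoint
  rw [Complex.coe_smul, Complex.coe_smul, cutDown, cutDown, ← cfcₙ_smul s _ a,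
    ← cfcₙ_comp_smul s _ a]
  refine cfcₙ_congr fun t _ => ?_
  simp only [smul_eq_mul]
  rw [← mul_sub, mul_max_of_nonneg _ _ hs.le, mul_zero]

theorem map_cutDown {F : Type*} [FunLike F A B] [NonUnitalAlgHomClass F ℂ A B] [StarHomClass F A B]
    (φ : F) {a : A} (ha : IsPos a) {ε : ℝ} (hε : 0 ≤ ε) :
    φ (cutDown ε a) = cutDown ε (φ a) := by
  have h0 : max (0 - ε) 0 = 0 := by simp [hε]
  have hs := ha.isSelfAdjoint
  have hs' := (ha.map φ).isSelfAdjoint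
  have hφ : Continuous (φ : A →⋆ₙₐ[ℂ] B) := by
    exact AddMonoidHomClass.continuous_of_bound φ 1 fun x => by
      rw [one_mul]
      exact NonUnitalStarAlgHom.norm_apply_le φ x
  exact NonUnitalStarAlgHom.map_cfcₙ (S := ℂ) (φ : A →⋆ₙₐ[ℂ] B) _ a (hφ := hφ)

/-- For `c < d` there is a contraction `g`, in the algebra generated by `a`, with
`g (a - c) g = (a - d)₊`. It is given by a continuous function with `g(t)² (t - c) = (t - d)₊`. -/
theorem exists_conjugate_eq_cutDown {a : A} (ha : IsPos a) {c d : ℝ} (hc : 0 ≤ c) (hd : c < d) :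
    ∃ g : A, star g = g ∧ ‖g‖ ≤ 1 ∧ star g * a * g - (c : ℂ) • (star g * g) = cutDown d a := by
  have hs := ha.isSelfAdjoint
  obtain ⟨g, gc, g0, hg, gsq⟩ : ∃ g : ℝ → ℝ, Continuous g ∧ g 0 = 0 ∧ (∀ t, 0 ≤ g t ∧ g t ≤ 1) ∧
      ∀ t, g t * t * g t - c • (g t * g t) = max (t - d) 0 := by
    -- The denominator `max (t - c) (d - c)` agrees with `t - c` where `(t - d)₊ ≠ 0`, and is never 0.
    have hpos : ∀ t : ℝ, 0 < max (t - c) (d - c) := fun t => lt_max_of_lt_right (by linarith)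
    refine ⟨fun t => √(max (t - d) 0 / max (t - c) (d - c)), ?_, ?_,
      fun t => ⟨Real.sqrt_nonneg _, ?_⟩, fun t => ?_⟩
    · refine Real.continuous_sqrt.comp (Continuous.div (by fun_prop) (by fun_prop) fun t => ?_)
      exact (hpos t).ne'
    · simp [hc.trans hd.le]
    · refine Real.sqrt_le_one.2 ?_
      rw [div_le_one (hpos t)]
      exact max_le_max (by linarith) (by linarith)
    · rw [mul_right_comm, Real.mul_self_sqrt (div_nonneg (le_max_right _ _) (hpos t).le),
        smul_eq_mul, mul_comm c, ← mul_sub]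
      rcases le_total t d with h | h
      · rw [max_eq_right (by linarith)]; simp
      · rw [max_eq_left (a := t - c) (by linarith), div_mul_cancel₀]
        linarith
  have hst : star (cfcₙ g a) = cfcₙ g a := (cfcₙ_predicate g a : IsSelfAdjoint _).star_eq
  have hh0 : max (0 - d) 0 = 0 := by rw [max_eq_right]; linarith
  refine ⟨cfcₙ g a, hst, norm_cfcₙ_le fun t _ => ?_, ?_⟩
  · rw [Real.norm_of_nonneg (hg t).1]
    exact (hg t).2
  · rw [hst, Complex.coe_smul, cutDown]
    conv_lhs =>
      enter [1, 1, 2]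
      rw [← cfcₙ_id' ℝ a]
    rw [← cfcₙ_mul _ _ a, ← cfcₙ_mul _ _ a, ← cfcₙ_mul _ _ a, ← cfcₙ_smul c _ a, ← cfcₙ_sub _ _ a]
    exact cfcₙ_congr fun t _ => gsq t

/-- Write `(s - δ)₊ = g s g` with a contraction `g` in the algebra generated by `s`. Then, for every
`r` with `r* r ≤ s`, the elements `r r*` and `r g g* r*` have distance at most `δ`. -/
theorem exists_compression {s : A} (hs : IsPos s) {δ : ℝ} (hδ : 0 < δ) :
    ∃ g : A, star g = g ∧ ‖g‖ ≤ 1 ∧ star g * s * g = cutDown δ s ∧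
      ∀ r : A, IsPos (s - star r * r) → ‖r * star r - r * (g * star g) * star r‖ ≤ δ := by
  have hsa := hs.isSelfAdjoint
  obtain ⟨g, gc, g0, hg, hgs⟩ : ∃ g : ℝ → ℝ, Continuous g ∧ g 0 = 0 ∧ (∀ t, 0 ≤ g t ∧ g t ≤ 1) ∧
      ∀ t, g t * t * g t = max (t - δ) 0 := by
    have hpos : ∀ t : ℝ, 0 < max t δ := fun t => lt_max_of_lt_right hδ
    refine ⟨fun t => √(max (t - δ) 0 / max t δ), ?_, ?_,
      fun t => ⟨Real.sqrt_nonneg _, ?_⟩, fun t => ?_⟩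
    · refine Real.continuous_sqrt.comp (Continuous.div (by fun_prop) (by fun_prop) fun t => ?_)
      exact (hpos t).ne'
    · simp [hδ.le]
    · refine Real.sqrt_le_one.2 ?_
      rw [div_le_one (hpos t)]
      exact max_le_max (by linarith) hδ.le
    · rw [mul_right_comm, Real.mul_self_sqrt (div_nonneg (le_max_right _ _) (hpos t).le)]
      rcases le_total t δ with h | h
      · rw [max_eq_right (by linarith)]; simp
      · rw [max_eq_left (a := t) h, div_mul_cancel₀]
        linarith
  -- `k = 1 - (1 - g²)^{1/2}` vanishes at `0`, so `r (1 - k)` makes sense without a unit.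
  obtain ⟨k, kc, k0, hk⟩ : ∃ k : ℝ → ℝ, Continuous k ∧ k 0 = 0 ∧
      ∀ t, k t + k t - k t * k t = g t * g t := by
    refine ⟨fun t => 1 - √(1 - g t * g t), by fun_prop, by simp [g0], fun t => ?_⟩
    have : √(1 - g t * g t) * √(1 - g t * g t) = 1 - g t * g t :=
      Real.mul_self_sqrt (by nlinarith [hg t])
    linarith
  have hst : star (cfcₙ g s) = cfcₙ g s := (cfcₙ_predicate g s : IsSelfAdjoint _).star_eq
  have hkt : star (cfcₙ k s) = cfcₙ k s := (cfcₙ_predicate k s : IsSelfAdjoint _).star_eq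
  have hh0 : max (0 - δ) 0 = 0 := by rw [max_eq_right]; linarith
  have hgs' : cfcₙ g s * s * cfcₙ g s = cutDown δ s := by
    rw [cutDown]
    conv_lhs =>
      enter [1, 2]
      rw [← cfcₙ_id' ℝ s]
    rw [← cfcₙ_mul _ _ s, ← cfcₙ_mul _ _ s]
    exact cfcₙ_congr fun t _ => hgs t
  have hkg : cfcₙ k s + cfcₙ k s - cfcₙ k s * cfcₙ k s = cfcₙ g s * cfcₙ g s := by
    rw [← cfcₙ_mul _ _ s, ← cfcₙ_mul _ _ s, ← cfcₙ_add _ _ s, ← cfcₙ_sub _ _ s]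
    exact cfcₙ_congr fun t _ => hk t
  have hsk : Commute s (cfcₙ k s) := by
    have := cfcₙ_commute_cfcₙ (fun t : ℝ => t) k s
    rwa [cfcₙ_id' ℝ s] at this
  have hsg : Commute s (cfcₙ g s) := by
    have := cfcₙ_commute_cfcₙ (fun t : ℝ => t) g s
    rwa [cfcₙ_id' ℝ s] at this
  have key : s - cfcₙ k s * s - s * cfcₙ k s + cfcₙ k s * s * cfcₙ k s = s - cutDown δ s := by
    rw [← hgs', hsg.symm.eq, mul_assoc s, ← hkg, hsk.symm.eq]
    noncomm_ring
  refine ⟨cfcₙ g s, hst, norm_cfcₙ_le fun t _ => ?_, ?_, fun r hr => ?_⟩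
  · rw [Real.norm_of_nonneg (hg t).1]
    exact (hg t).2
  · rw [hst, hgs']
  · generalize cfcₙ k s = k at *
    generalize cfcₙ g s = g at *
    obtain ⟨w, hw⟩ := hr
    -- `r (1 - g²) r* = (r (1 - k)) (r (1 - k))*`, whose norm is that of
    -- `(1 - k) r* r (1 - k) ≤ (1 - k) s (1 - k) = s - (s - δ)₊`.
    have h1 : r * star r - r * (g * star g) * star r = (r - r * k) * star (r - r * k) := by
      rw [hst, ← hkg, star_sub, star_mul, hkt]
      noncomm_ring
    rw [h1, CStarRing.norm_self_mul_star, ← CStarRing.norm_star_mul_self]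
    refine ((isPos_star_mul_self _).norm_le (b := s - cutDown δ s) ?_).trans
      (norm_sub_cutDown_le hs hδ.le)
    refine ⟨w - w * k, ?_⟩
    have h2 : s = star r * r + star w * w := by rw [← hw]; abel
    rw [← key]
    simp only [star_sub, star_mul, hkt]
    nth_rw 1 2 3 4 [h2]
    noncomm_ring

end Positive

/-! ### Trace inequalities for cut-downs -/

section Trace
variable {A B : Type*} [NonUnitalCStarAlgebra A] [NonUnitalCStarAlgebra B]

namespace IsTrace
variable {τ : A → ℝ≥0∞}

theorem map_add (hτ : IsTrace τ) {a b : A} (ha : IsPos a) (hb : IsPos b) :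
    τ (a + b) = τ a + τ b := by
  simpa using hτ.map_combination 1 1 a b one_pos one_pos ha hb

theorem map_smul (hτ : IsTrace τ) {a : A} (ha : IsPos a) {s : ℝ} (hs : 0 < s) :
    τ ((s : ℂ) • a) = ENNReal.ofReal s * τ a := by
  simpa [hτ.map_zero] using hτ.map_combination s 1 a 0 hs one_pos ha isPos_zero

theorem map_sum (hτ : IsTrace τ) {ι : Type*} {s : Finset ι} {f : ι → A}
    (h : ∀ i ∈ s, IsPos (f i)) :
    τ (∑ i ∈ s, f i) = ∑ i ∈ s, τ (f i) := by
  classical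
  induction s using Finset.induction_on with
  | empty => simp [hτ.map_zero]
  | insert i s hi ih =>
    rw [Finset.sum_insert hi, Finset.sum_insert hi, hτ.map_add (h i (by simp))
      (IsPos.sum fun j hj => h j (by simp [hj])), ih fun j hj => h j (by simp [hj])]

theorem mono (hτ : IsTrace τ) {a b : A} (ha : IsPos a) (hab : IsPos (b - a)) : τ a ≤ τ b := by
  have := hτ.map_add ha hab
  rw [add_sub_cancel] at this
  rw [this]
  exact le_self_add

theorem map_conjugate_le (hτ : IsTrace τ) {b g : A} (hb : IsPos b) (hg : ‖g‖ ≤ 1) :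
    τ (star g * b * g) ≤ τ b := by
  obtain ⟨r, rfl⟩ := hb
  have h1 : star g * (star r * r) * g = star (r * g) * (r * g) := by
    simp only [star_mul, mul_assoc]
  rw [h1, hτ.map_star_mul_self, hτ.map_star_mul_self r]
  refine hτ.mono (isPos_mul_star_self _) ?_
  have := isPos_mul_star_sub (z := r) hg
  simpa only [star_mul, mul_assoc] using this

/-- Traces are continuous up to cut-downs: with `g` as in `exists_conjugate_eq_cutDown`,
`(a - d)₊ = g (a - c) g ≤ g b g`. -/
theorem map_cutDown_le (hτ : IsTrace τ) {a b : A} (ha : IsPos a) (hb : IsPos b) {c d : ℝ}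
    (hab : ‖a - b‖ ≤ c) (hcd : c < d) : τ (cutDown d a) ≤ τ b := by
  obtain ⟨g, _, hg1, hg⟩ := exists_conjugate_eq_cutDown ha ((norm_nonneg _).trans hab) hcd
  refine le_trans ?_ (hτ.map_conjugate_le hb hg1)
  refine hτ.mono (isPos_cutDown _ _) ?_
  have := isPos_norm_smul_sub_conjugate (ha.isSelfAdjoint.sub hb.isSelfAdjoint) hab g
  convert this using 1
  rw [← hg]
  noncomm_ring

/-- Superadditivity of traces of cut-downs. With `s = a + b` and `g` as in `exists_compression`, the
element `a = r r` is close to `r g g* r`, which is equivalent to `g* a g`, and likewise for `b`;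
finally `g* a g + g* b g = (s - δ)₊`. -/
theorem map_cutDown_add_le (hτ : IsTrace τ) {a b : A} (ha : IsPos a) (hb : IsPos b) {δ ε : ℝ}
    (hδ : 0 < δ) (hε : δ < ε) : τ (cutDown ε a) + τ (cutDown ε b) ≤ τ (cutDown δ (a + b)) := by
  obtain ⟨g, hg, hg1, hgs, hr⟩ := exists_compression (ha.add hb) hδ
  have key : ∀ x : A, IsPos x → IsPos (a + b - x) → τ (cutDown ε x) ≤ τ (star g * x * g) := by
    intro x hx hxs
    obtain ⟨r, hr1, rfl⟩ := hx.exists_sqrt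
    have h1 := hr r (by rwa [hr1])
    rw [hr1] at h1
    have h2 : star (star g * r) * (star g * r) = r * (g * star g) * r := by
      simp only [star_mul, hr1, star_star, mul_assoc]
    have h3 : star g * r * star (star g * r) = star g * (r * r) * g := by
      simp only [star_mul, hr1, star_star, mul_assoc]
    rw [← h3, ← hτ.map_star_mul_self]
    refine hτ.map_cutDown_le hx (isPos_star_mul_self _) ?_ hε
    rwa [h2]
  have ha' := key a ha (by rwa [add_sub_cancel_left])
  have hb' := key b hb (by rwa [add_sub_cancel_right])
  refine (add_le_add ha' hb').trans ?_
  rw [← hτ.map_add (ha.star_left_conjugate g) (hb.star_left_conjugate g), ← add_mul, ← mul_add, hgs]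

/-- The trace property for cut-downs. With `g` as in `exists_compression` for `s = z* z`, the element
`z z*` is close to `z g g* z*`, which is equivalent to `g* z* z g = (s - δ)₊`. -/
theorem map_cutDown_mul_star_le (hτ : IsTrace τ) (z : A) {δ ε : ℝ} (hδ : 0 < δ) (hε : δ < ε) :
    τ (cutDown ε (z * star z)) ≤ τ (cutDown δ (star z * z)) := by
  obtain ⟨g, hg, hg1, hgs, hr⟩ := exists_compression (isPos_star_mul_self z) hδ
  have h1 := hr z (by rw [sub_self]; exact isPos_zero)
  have h2 : (z * g) * star (z * g) = z * (g * star g) * star z := by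
    simp only [star_mul, mul_assoc]
  have h3 : star (z * g) * (z * g) = cutDown δ (star z * z) := by
    rw [← hgs]; simp only [star_mul, mul_assoc]
  rw [← h3, hτ.map_star_mul_self]
  refine hτ.map_cutDown_le (isPos_mul_star_self _) (isPos_mul_star_self _) ?_ hε
  rwa [h2]

theorem map_cutDown_anti (hτ : IsTrace τ) {a : A} (ha : IsPos a) {δ ε : ℝ} (hδ : 0 ≤ δ)
    (hε : δ ≤ ε) :
    τ (cutDown ε a) ≤ τ (cutDown δ a) := by
  have h := cutDown_cutDown ha hδ (sub_nonneg.2 hε)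
  rw [add_sub_cancel] at h
  rw [← h]
  exact hτ.mono (isPos_cutDown _ _) (isPos_sub_cutDown (isPos_cutDown _ _) (sub_nonneg.2 hε))

theorem comp {σ : B → ℝ≥0∞} (hσ : IsTrace σ) {F : Type*} [FunLike F A B]
    [NonUnitalAlgHomClass F ℂ A B] [StarHomClass F A B] (φ : F) : IsTrace fun a => σ (φ a) where
  map_zero := by rw [_root_.map_zero, hσ.map_zero]
  map_combination s t a b hs ht ha hb := by
    rw [_root_.map_add, _root_.map_smul, _root_.map_smul]
    exact hσ.map_combination s t _ _ hs ht (ha.map φ) (hb.map φ)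
  map_star_mul_self a := by
    simp only [map_mul, map_star, hσ.map_star_mul_self]

end IsTrace

theorem IsLscTrace.comp {σ : B → ℝ≥0∞} (hσ : IsLscTrace σ) {F : Type*} [FunLike F A B]
    [NonUnitalAlgHomClass F ℂ A B] [StarHomClass F A B] (φ : F) : IsLscTrace fun a => σ (φ a) where
  toIsTrace := hσ.toIsTrace.comp φ
  lowerSemicontinuousOn := by
    have hφ : Continuous φ := AddMonoidHomClass.continuous_of_bound φ 1 fun x => by
      rw [one_mul]
      exact NonUnitalStarAlgHom.norm_apply_le φ x
    exact hσ.lowerSemicontinuousOn.comp hφ.continuousOn fun a ha => ha.map φ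

end Trace

/-! ### Functoriality of ultrapowers -/

section Hom
variable {A B : Type*} [NonUnitalCStarAlgebra A] [NonUnitalCStarAlgebra B]

/-- The quotient map as a `*`-homomorphism. -/
def ClosedIdeal.projHom (I : ClosedIdeal A) : A →⋆ₙₐ[ℂ] I.Quot where
  toFun := I.proj
  map_smul' := map_smul I.proj
  map_zero' := map_zero I.proj
  map_add' := map_add I.proj
  map_mul' := I.proj_mul
  map_star' := I.proj_star

theorem ClosedIdeal.projHom_apply (I : ClosedIdeal A) (x : A) : I.projHom x = I.proj x := rfl

theorem ClosedIdeal.exists_isPos_lift (I : ClosedIdeal A) {q : I.Quot} (hq : IsPos q) :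
    ∃ x, IsPos x ∧ I.proj x = q := by
  obtain ⟨r, rfl⟩ := hq
  obtain ⟨s, rfl⟩ := I.proj_surjective r
  exact ⟨star s * s, isPos_star_mul_self s, rfl⟩

/-- Evaluation of bounded sequences at `n`. -/
def evalHom (A : Type*) [NonUnitalCStarAlgebra A] (n : ℕ) : BddSeq A →⋆ₙₐ[ℂ] A where
  toFun x := x n
  map_smul' _ _ := rfl
  map_zero' := rfl
  map_add' _ _ := rfl
  map_mul' _ _ := rfl
  map_star' _ := rfl

/-- The bounded sequence with entries `f n`. -/
def mkSeq (f : ℕ → A) (C : ℝ) (h : ∀ n, ‖f n‖ ≤ C) : BddSeq A :=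
  ⟨f, memℓp_infty ⟨C, by rintro _ ⟨n, rfl⟩; exact h n⟩⟩

theorem norm_seq_apply_le (x : BddSeq A) (n : ℕ) : ‖x n‖ ≤ ‖x‖ :=
  lp.norm_apply_le_norm ENNReal.top_ne_zero x n

/-- A `*`-homomorphism applied entrywise to bounded sequences. -/
def mapSeq (φ : A →⋆ₙₐ[ℂ] B) : BddSeq A →⋆ₙₐ[ℂ] BddSeq B where
  toFun x := mkSeq (fun n => φ (x n)) ‖x‖ fun n =>
    (NonUnitalStarAlgHom.norm_apply_le φ _).trans (norm_seq_apply_le x n)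
  map_smul' c x := by ext n; exact map_smul φ c (x n)
  map_zero' := by ext n; exact map_zero φ
  map_add' x y := by ext n; exact map_add φ (x n) (y n)
  map_mul' x y := by ext n; exact map_mul φ (x n) (y n)
  map_star' x := by ext n; exact map_star φ (x n)

theorem mapSeq_apply (φ : A →⋆ₙₐ[ℂ] B) (x : BddSeq A) (n : ℕ) : mapSeq φ x n = φ (x n) := rfl

variable (ω : Ultrafilter ℕ)

theorem proj_eq_proj_iff_tendsto {x y : BddSeq A} :
    (nullIdeal ω A).proj x = (nullIdeal ω A).proj y ↔
      Tendsto (fun n => ‖x n - y n‖) ω (𝓝 0) :=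
  (nullIdeal ω A).proj_eq_proj

theorem proj_eq_proj_of_eventually {x y : BddSeq A} (h : ∀ᶠ n in (ω : Filter ℕ), x n = y n) :
    (nullIdeal ω A).proj x = (nullIdeal ω A).proj y := by
  rw [proj_eq_proj_iff_tendsto]
  refine tendsto_const_nhds.congr' ?_
  filter_upwards [h] with n hn
  rw [hn, sub_self, norm_zero]

/-- The `*`-homomorphism `A_ω → B_ω` induced by `A → B`. -/
def mapUltra (φ : A →⋆ₙₐ[ℂ] B) : Ultrapower ω A →⋆ₙₐ[ℂ] Ultrapower ω B :=
  have hker : ∀ x ∈ (nullIdeal ω A).toSubmodule,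
      ((nullIdeal ω B).proj.comp (mapSeq φ : BddSeq A →ₗ[ℂ] BddSeq B)) x = 0 := fun x hx => by
    refine (Submodule.Quotient.mk_eq_zero _).2 ?_
    exact squeeze_zero (fun n => norm_nonneg _)
      (fun n => NonUnitalStarAlgHom.norm_apply_le φ (x n)) hx
  let f : Ultrapower ω A →ₗ[ℂ] Ultrapower ω B :=
    (nullIdeal ω A).toSubmodule.liftQ
      ((nullIdeal ω B).proj.comp (mapSeq φ : BddSeq A →ₗ[ℂ] BddSeq B)) hker
  { toFun := f
    map_smul' := map_smul f
    map_zero' := map_zero f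
    map_add' := map_add f
    map_mul' := by
      intro p q
      obtain ⟨x, rfl⟩ := (nullIdeal ω A).proj_surjective p
      obtain ⟨y, rfl⟩ := (nullIdeal ω A).proj_surjective q
      change (nullIdeal ω B).proj (mapSeq φ (x * y)) = _
      rw [map_mul]
      rfl
    map_star' := by
      intro p
      obtain ⟨x, rfl⟩ := (nullIdeal ω A).proj_surjective p
      change (nullIdeal ω B).proj (mapSeq φ (star x)) = _
      rw [map_star]
      rfl }

theorem mapUltra_proj (φ : A →⋆ₙₐ[ℂ] B) (x : BddSeq A) :
    mapUltra ω φ ((nullIdeal ω A).proj x) = (nullIdeal ω B).proj (mapSeq φ x) := rfl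

theorem mapUltra_diag (φ : A →⋆ₙₐ[ℂ] B) (a : A) : mapUltra ω φ (diag ω a) = diag ω (φ a) := rfl

theorem mapUltra_injective {φ : A →⋆ₙₐ[ℂ] B} (hφ : Function.Injective φ) :
    Function.Injective (mapUltra ω φ) := by
  intro p q h
  obtain ⟨x, rfl⟩ := (nullIdeal ω A).proj_surjective p
  obtain ⟨y, rfl⟩ := (nullIdeal ω A).proj_surjective q
  rw [mapUltra_proj, mapUltra_proj, proj_eq_proj_iff_tendsto] at h
  rw [proj_eq_proj_iff_tendsto]
  refine h.congr fun n => ?_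
  rw [mapSeq_apply, mapSeq_apply, ← map_sub, NonUnitalStarAlgHom.norm_map φ hφ]

/-- The diagonal embedding as a `*`-homomorphism. -/
def diagHom : A →⋆ₙₐ[ℂ] Ultrapower ω A where
  toFun := diag ω
  map_smul' _ _ := rfl
  map_zero' := rfl
  map_add' _ _ := rfl
  map_mul' _ _ := rfl
  map_star' _ := rfl

theorem diagHom_apply (a : A) : diagHom ω a = diag ω a := rfl

theorem continuous_diag : Continuous (diag ω : A → Ultrapower ω A) :=
  AddMonoidHomClass.continuous_of_bound (diagHom ω) 1 fun x => by
    rw [one_mul]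
    exact NonUnitalStarAlgHom.norm_apply_le (diagHom ω) x

end Hom

/-! ### Generalised limit traces -/

section LimTrace
variable {A B : Type*} [NonUnitalCStarAlgebra A] [NonUnitalCStarAlgebra B]
variable (ω : Ultrafilter ℕ)

theorem tendsto_limUnder (f : ℕ → ℝ≥0∞) :
    Tendsto f ω (𝓝 (limUnder (ω : Filter ℕ) f)) := by
  obtain ⟨a, -, ha⟩ := isCompact_univ.ultrafilter_le_nhds (ω.map f) (by simp)
  exact tendsto_nhds_limUnder ⟨a, ha⟩

theorem limUnder_mono {f g : ℕ → ℝ≥0∞} (h : ∀ᶠ n in (ω : Filter ℕ), f n ≤ g n) :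
    limUnder (ω : Filter ℕ) f ≤ limUnder (ω : Filter ℕ) g :=
  le_of_tendsto_of_tendsto (tendsto_limUnder ω f) (tendsto_limUnder ω g) h

theorem limUnder_add (f g : ℕ → ℝ≥0∞) :
    limUnder (ω : Filter ℕ) (fun n => f n + g n) =
      limUnder (ω : Filter ℕ) f + limUnder (ω : Filter ℕ) g :=
  ((tendsto_limUnder ω f).add (tendsto_limUnder ω g)).limUnder_eq

/-- The value `sup_{ε > 0} lim_{n → ω} τ n ((x n - ε)₊)` on a bounded sequence `x`. The limit along
the ultrafilter exists by compactness of `[0, ∞]`: `tendsto_limUnder`. -/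
def limTrace (τ : ℕ → A → ℝ≥0∞) (x : BddSeq A) : ℝ≥0∞ :=
  ⨆ (ε : ℝ) (_ : 0 < ε), limUnder (ω : Filter ℕ) fun n => τ n (cutDown ε (x n))

variable {ω} {τ : ℕ → A → ℝ≥0∞} {x y : BddSeq A}

theorem IsPos.apply (hx : IsPos x) (n : ℕ) : IsPos (x n) := hx.map (evalHom A n)

theorem limTrace_le {C : ℝ≥0∞}
    (h : ∀ ε > 0, limUnder (ω : Filter ℕ) (fun n => τ n (cutDown ε (x n))) ≤ C) :
    limTrace ω τ x ≤ C := iSup₂_le h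

theorem le_limTrace {ε : ℝ} (hε : 0 < ε) :
    limUnder (ω : Filter ℕ) (fun n => τ n (cutDown ε (x n))) ≤ limTrace ω τ x :=
  le_iSup₂ (f := fun (ε : ℝ) (_ : 0 < ε) =>
    limUnder (ω : Filter ℕ) fun n => τ n (cutDown ε (x n))) ε hε

/-- Half of the fact that `limTrace ω τ x` depends only on the class of `x` in `A_ω`. -/
theorem limTrace_mono_of_proj_eq (hτ : ∀ n, IsTrace (τ n)) (hx : IsPos x) (hy : IsPos y)
    (h : (nullIdeal ω A).proj x = (nullIdeal ω A).proj y) : limTrace ω τ x ≤ limTrace ω τ y := by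
  rw [proj_eq_proj_iff_tendsto] at h
  refine limTrace_le fun ε hε => ?_
  refine (limUnder_mono ω ?_).trans (le_limTrace (τ := τ) (x := y) (by positivity : 0 < ε / 4))
  -- `x n` is within `ε/4` of `y n`, hence within `ε/2` of `(y n - ε/4)₊`.
  filter_upwards [h.eventually_le_const (by positivity : 0 < ε / 4)] with n hn
  refine (hτ n).map_cutDown_le (hx.apply n) (isPos_cutDown _ _) (c := ε / 2) ?_ (by linarith)
  have h1 := norm_sub_cutDown_le (hy.apply n) (by positivity : 0 ≤ ε / 4)
  have h2 := norm_add_le (x n - y n) (y n - cutDown (ε / 4) (y n))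
  rw [sub_add_sub_cancel] at h2
  linarith

theorem limTrace_congr (hτ : ∀ n, IsTrace (τ n)) (hx : IsPos x) (hy : IsPos y)
    (h : (nullIdeal ω A).proj x = (nullIdeal ω A).proj y) : limTrace ω τ x = limTrace ω τ y :=
  (limTrace_mono_of_proj_eq hτ hx hy h).antisymm (limTrace_mono_of_proj_eq hτ hy hx h.symm)

theorem limTrace_zero (hτ : ∀ n, IsTrace (τ n)) : limTrace ω τ 0 = 0 := by
  refine le_antisymm (limTrace_le fun ε hε => ?_) zero_le
  have : ∀ n, τ n (cutDown ε ((0 : BddSeq A) n)) = 0 := fun n => by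
    rw [lp.coeFn_zero, Pi.zero_apply, cutDown, cfcₙ_apply_zero, (hτ n).map_zero]
  simp only [this]
  exact (tendsto_const_nhds.limUnder_eq).le

theorem limTrace_add (hτ : ∀ n, IsTrace (τ n)) (hx : IsPos x) (hy : IsPos y) :
    limTrace ω τ (x + y) = limTrace ω τ x + limTrace ω τ y := by
  refine le_antisymm (limTrace_le fun ε hε => ?_) ?_
  · -- `x n + y n` is within `ε/2` of `(x n - ε/4)₊ + (y n - ε/4)₊`.
    have h4 : 0 < ε / 4 := by positivity
    refine le_trans ?_ (add_le_add (le_limTrace (τ := τ) (x := x) h4)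
      (le_limTrace (τ := τ) (x := y) h4))
    rw [← limUnder_add]
    refine limUnder_mono ω (Eventually.of_forall fun n => ?_)
    rw [← (hτ n).map_add (isPos_cutDown _ _) (isPos_cutDown _ _)]
    refine (hτ n).map_cutDown_le ((hx.add hy).apply n) ((isPos_cutDown _ _).add (isPos_cutDown _ _))
      (c := ε / 2) ?_ (by linarith)
    have h1 := norm_sub_cutDown_le (hx.apply n) h4.le
    have h2 := norm_sub_cutDown_le (hy.apply n) h4.le
    have h3 := norm_add_le (x n - cutDown (ε / 4) (x n)) (y n - cutDown (ε / 4) (y n))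
    rw [← add_sub_add_comm] at h3
    rw [lp.coeFn_add, Pi.add_apply]
    linarith
  · refine ENNReal.biSup_add_biSup_le' ⟨1, one_pos⟩ ⟨1, one_pos⟩ fun ε hε δ hδ => ?_
    have hm : 0 < min ε δ := lt_min hε hδ
    have hm2 : 0 < min ε δ / 2 := by positivity
    refine le_trans ?_ (le_limTrace hm2)
    rw [← limUnder_add]
    refine limUnder_mono ω (Eventually.of_forall fun n => ?_)
    refine (add_le_add ((hτ n).map_cutDown_anti (hx.apply n) hm.le (min_le_left _ _))
      ((hτ n).map_cutDown_anti (hy.apply n) hm.le (min_le_right _ _))).trans ?_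
    exact (hτ n).map_cutDown_add_le (hx.apply n) (hy.apply n) hm2 (by linarith)

theorem limTrace_smul (hτ : ∀ n, IsTrace (τ n)) (hx : IsPos x) {s : ℝ} (hs : 0 < s) :
    limTrace ω τ ((s : ℂ) • x) = ENNReal.ofReal s * limTrace ω τ x := by
  have key : ∀ ε > 0, limUnder (ω : Filter ℕ) (fun n => τ n (cutDown (s * ε) (((s : ℂ) • x) n))) =
      ENNReal.ofReal s * limUnder (ω : Filter ℕ) fun n => τ n (cutDown ε (x n)) := by
    intro ε hε
    refine Tendsto.limUnder_eq ?_
    refine (ENNReal.Tendsto.const_mul (tendsto_limUnder ω _) (Or.inr ENNReal.ofReal_ne_top)).congr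
      fun n => ?_
    rw [lp.coeFn_smul, Pi.smul_apply, cutDown_smul (hx.apply n) hε.le hs,
      (hτ n).map_smul (isPos_cutDown _ _) hs]
  refine le_antisymm (limTrace_le fun ε hε => ?_) ?_
  · have := key (ε / s) (by positivity)
    rw [mul_div_cancel₀ _ hs.ne'] at this
    rw [this]
    gcongr
    exact le_limTrace (by positivity)
  · rw [limTrace, ENNReal.mul_iSup]
    refine iSup_le fun ε => ?_
    rw [ENNReal.mul_iSup]
    refine iSup_le fun hε => ?_
    rw [← key ε hε]
    exact le_limTrace (by positivity)

theorem limTrace_mul_star_le (hτ : ∀ n, IsTrace (τ n)) (z : BddSeq A) :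
    limTrace ω τ (z * star z) ≤ limTrace ω τ (star z * z) := by
  refine limTrace_le fun ε hε => ?_
  have h2 : 0 < ε / 2 := by positivity
  refine (limUnder_mono ω (Eventually.of_forall fun n => ?_)).trans (le_limTrace h2)
  exact (hτ n).map_cutDown_mul_star_le (z n) h2 (by linarith)

variable (ω) in
/-- Every sequence of lower semicontinuous traces on `A` induces a generalised limit trace. -/
theorem exists_isGeneralisedLimitTrace (hτ : ∀ n, IsLscTrace (τ n)) :
    ∃ σ : Ultrapower ω A → ℝ≥0∞, IsGeneralisedLimitTrace ω σ ∧
      ∀ x : BddSeq A, IsPos x → σ ((nullIdeal ω A).proj x) = limTrace ω τ x := by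
  have hτ' : ∀ n, IsTrace (τ n) := fun n => (hτ n).toIsTrace
  -- The supremum runs over equal values; it is empty, hence 0, if `q` is not positive.
  let σ : Ultrapower ω A → ℝ≥0∞ := fun q =>
    ⨆ (x : BddSeq A) (_ : IsPos x ∧ (nullIdeal ω A).proj x = q), limTrace ω τ x
  have hσ : ∀ x : BddSeq A, IsPos x → σ ((nullIdeal ω A).proj x) = limTrace ω τ x := by
    intro x hx
    refine le_antisymm (iSup₂_le fun y hy => (limTrace_congr hτ' hy.1 hx hy.2).le) ?_
    exact le_iSup₂ (f := fun (y : BddSeq A)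
      (_ : IsPos y ∧ (nullIdeal ω A).proj y = (nullIdeal ω A).proj x) => limTrace ω τ y) x ⟨hx, rfl⟩
  refine ⟨σ, ⟨⟨?_, ?_, ?_⟩, τ, hτ, hσ⟩, hσ⟩
  · rw [← map_zero (nullIdeal ω A).proj, hσ 0 isPos_zero, limTrace_zero hτ']
  · intro s t p q hs ht hp hq
    obtain ⟨x, hx, rfl⟩ := (nullIdeal ω A).exists_isPos_lift hp
    obtain ⟨y, hy, rfl⟩ := (nullIdeal ω A).exists_isPos_lift hq
    rw [← map_smul, ← map_smul, ← map_add, hσ _ ((hx.smul hs.le).add (hy.smul ht.le)), hσ _ hx,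
      hσ _ hy, limTrace_add hτ' (hx.smul hs.le) (hy.smul ht.le), limTrace_smul hτ' hx hs,
      limTrace_smul hτ' hy ht]
  · intro p
    obtain ⟨z, rfl⟩ := (nullIdeal ω A).proj_surjective p
    rw [← ClosedIdeal.proj_star, ← ClosedIdeal.proj_mul, ← ClosedIdeal.proj_mul,
      hσ _ (isPos_star_mul_self z), hσ _ (isPos_mul_star_self z)]
    refine le_antisymm ?_ (limTrace_mul_star_le hτ' z)
    have := limTrace_mul_star_le (ω := ω) hτ' (star z)
    rwa [star_star] at this

namespace IsGeneralisedLimitTrace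
variable {σ : Ultrapower ω A → ℝ≥0∞}

/-- Generalised limit traces are determined by their values on cut-downs. -/
theorem le_iSup_cutDown (hσ : IsGeneralisedLimitTrace ω σ) {q : Ultrapower ω A} (hq : IsPos q) :
    σ q ≤ ⨆ (ε : ℝ) (_ : 0 < ε), σ (cutDown ε q) := by
  obtain ⟨hσ, τ, hτ, h⟩ := hσ
  obtain ⟨x, hx, rfl⟩ := (nullIdeal ω A).exists_isPos_lift hq
  rw [h x hx]
  refine iSup₂_le fun ε hε => ?_
  have h2 : 0 < ε / 2 := by positivity
  refine le_trans ?_ (le_iSup₂ (f := fun (ε : ℝ) (_ : 0 < ε) => _) (ε / 2) h2)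
  have h3 := map_cutDown (nullIdeal ω A).projHom hx h2.le
  rw [ClosedIdeal.projHom_apply, ClosedIdeal.projHom_apply] at h3
  rw [← h3, h _ (isPos_cutDown _ _)]
  refine le_trans ?_ (le_limTrace h2)
  refine limUnder_mono ω (Eventually.of_forall fun n => ?_)
  have h4 : (cutDown (ε / 2) x) n = cutDown (ε / 2) (x n) := map_cutDown (evalHom A n) hx h2.le
  rw [h4, cutDown_cutDown (hx.apply n) h2.le h2.le, add_halves]

/-- Generalised limit traces are lower semicontinuous, hence continuous along convergence from
below. -/
theorem tendsto_of_le (hσ : IsGeneralisedLimitTrace ω σ) {α : Type*} {l : Filter α}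
    {f : α → Ultrapower ω A} {q : Ultrapower ω A} (hq : IsPos q) (hf : Tendsto f l (𝓝 q))
    (hpos : ∀ᶠ i in l, IsPos (f i)) (hle : ∀ᶠ i in l, IsPos (q - f i)) :
    Tendsto (fun i => σ (f i)) l (𝓝 (σ q)) := by
  refine tendsto_order.2 ⟨fun c hc => ?_, fun c hc => ?_⟩
  · have h1 := hc.trans_le (hσ.le_iSup_cutDown hq)
    simp only [lt_iSup_iff] at h1
    obtain ⟨ε, hε, h1⟩ := h1
    have h2 := (Metric.tendsto_nhds.1 hf) (ε / 2) (by positivity)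
    filter_upwards [h2, hpos] with i hi hi'
    rw [dist_comm, dist_eq_norm] at hi
    exact h1.trans_le (hσ.1.map_cutDown_le hq hi' hi.le (by linarith))
  · filter_upwards [hpos, hle] with i h1 h2
    exact (hσ.1.mono h1 h2).trans_lt hc

/-- Generalised limit traces pull back along the map of ultrapowers induced by `φ : A → B`. -/
theorem comp_mapUltra {σ : Ultrapower ω B → ℝ≥0∞} (hσ : IsGeneralisedLimitTrace ω σ)
    (φ : A →⋆ₙₐ[ℂ] B) : IsGeneralisedLimitTrace ω fun q => σ (mapUltra ω φ q) := by
  obtain ⟨hσ, τ, hτ, h⟩ := hσ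
  refine ⟨hσ.comp _, fun n a => τ n (φ a), fun n => (hτ n).comp φ, fun x hx => ?_⟩
  change σ ((nullIdeal ω B).proj (mapSeq φ x)) = _
  rw [h _ (hx.map _)]
  refine iSup_congr fun ε => iSup_congr fun hε => ?_
  congr 1
  funext n
  exact congrArg (τ n) (map_cutDown φ (hx.apply n) hε.le).symm

end IsGeneralisedLimitTrace
end LimTrace

/-! ### Matrix systems -/

/-- Approximate units, as a filter and without reference to an order on `B`. -/
theorem exists_approximateUnit (B : Type*) [NonUnitalCStarAlgebra B] :
    ∃ l : Filter B, l.NeBot ∧ (∀ᶠ u in l, IsPos u ∧ ‖u‖ ≤ 1) ∧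
      ∀ b : B, Tendsto (fun u => u * b) l (𝓝 b) := by
  let : PartialOrder B := CStarAlgebra.spectralOrder _
  have : StarOrderedRing B := CStarAlgebra.spectralOrderedRing _
  have hl := CStarAlgebra.increasingApproximateUnit B
  refine ⟨_, hl.neBot, ?_, fun b => hl.tendsto_mul_right b⟩
  filter_upwards [hl.eventually_nonneg, hl.eventually_norm] with u h0 h1
  exact ⟨isPos_iff_nonneg.2 h0, h1⟩

/-- A presentation of a C*-algebra `E` as the stabilisation of `B`: the element `ι i j b` plays the
role of `b ⊗ e_{ij}`, with `e_{ij}` the matrix units. Sums of such elements are required to be dense;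
these sums form a subspace, since each `ι i j` is linear. -/
structure MatrixSystem (B E : Type*) [NonUnitalCStarAlgebra B] [NonUnitalCStarAlgebra E] where
  ι : ℕ → ℕ → B →ₗ[ℂ] E
  ι_mul : ∀ i j k l a b, ι i j a * ι k l b = if j = k then ι i l (a * b) else 0
  star_ι : ∀ i j a, star (ι i j a) = ι j i (star a)
  dense : Dense (AddSubmonoid.closure (⋃ i, ⋃ j, Set.range (ι i j)) : Set E)
  injective : Function.Injective (ι 0 0)

namespace MatrixSystem
variable {B E : Type*} [NonUnitalCStarAlgebra B] [NonUnitalCStarAlgebra E] (M : MatrixSystem B E)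

theorem ι_mul_self (i j l : ℕ) (a b : B) : M.ι i j a * M.ι j l b = M.ι i l (a * b) := by
  rw [M.ι_mul, if_pos rfl]

@[elab_as_elim]
theorem induction {p : E → Prop} (c : E) (hp : IsClosed {c | p c}) (zero : p 0)
    (add : ∀ c d, p c → p d → p (c + d)) (gen : ∀ i j b, p (M.ι i j b)) : p c := by
  have h : (AddSubmonoid.closure (⋃ i, ⋃ j, Set.range (M.ι i j)) : Set E) ⊆ {c | p c} := by
    intro c hc
    induction hc using AddSubmonoid.closure_induction with
    | mem x hx =>
      simp only [Set.mem_iUnion, Set.mem_range] at hx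
      obtain ⟨i, j, b, rfl⟩ := hx
      exact gen i j b
    | zero => exact zero
    | add x y _ _ hx hy => exact add x y hx hy
  exact hp.closure_subset_iff.2 h (M.dense c)

/-- The embedding `b ↦ b ⊗ e_{kk}`. -/
def hom (k : ℕ) : B →⋆ₙₐ[ℂ] E where
  toFun := M.ι k k
  map_smul' := map_smul (M.ι k k)
  map_zero' := map_zero (M.ι k k)
  map_add' := map_add (M.ι k k)
  map_mul' a b := (M.ι_mul_self k k k a b).symm
  map_star' a := (M.star_ι k k a).symm

theorem hom_apply (k : ℕ) (b : B) : M.hom k b = M.ι k k b := rfl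

/-- All diagonal embeddings are injective, as `b ⊗ e_{kk} = 0` implies
`b* b (b* b)* ⊗ e_{00} = (b* ⊗ e_{0k}) (b ⊗ e_{kk}) (…) = 0`. -/
theorem hom_injective (k : ℕ) : Function.Injective (M.hom k) := by
  refine (injective_iff_map_eq_zero _).2 fun a ha => ?_
  rw [hom_apply] at ha
  have h1 : M.ι 0 0 (star a * a * star (star a * a)) = 0 := by
    rw [← M.ι_mul_self 0 k 0, ← M.ι_mul_self 0 k k, ha, mul_zero, zero_mul]
  rw [map_eq_zero_iff _ M.injective, CStarRing.mul_star_self_eq_zero_iff,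
    CStarRing.star_mul_self_eq_zero_iff] at h1
  exact h1

theorem norm_ι (i j : ℕ) (a : B) : ‖M.ι i j a‖ = ‖a‖ := by
  have h : ‖M.ι i j a‖ * ‖M.ι i j a‖ = ‖a‖ * ‖a‖ := by
    rw [← CStarRing.norm_star_mul_self, ← CStarRing.norm_star_mul_self, M.star_ι, M.ι_mul_self,
      ← hom_apply, NonUnitalStarAlgHom.norm_map _ (M.hom_injective j)]
  exact (mul_self_inj (norm_nonneg _) (norm_nonneg _)).1 h

theorem continuous_ι (i j : ℕ) : Continuous (M.ι i j) :=
  AddMonoidHomClass.continuous_of_bound (M.ι i j) 1 fun x => by rw [one_mul, M.norm_ι]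

/-- The embedding `b ↦ b ⊗ (e_{00} + ⋯ + e_{m-1,m-1})`. -/
def blockHom (m : ℕ) : B →⋆ₙₐ[ℂ] E where
  toFun b := ∑ k ∈ Finset.range m, M.ι k k b
  map_smul' c b := by simp only [map_smul, Finset.smul_sum]; rfl
  map_zero' := by simp
  map_add' a b := by simp only [map_add, Finset.sum_add_distrib]
  map_mul' a b := by
    rw [Finset.sum_mul_sum]
    refine Finset.sum_congr rfl fun i hi => ?_
    simp only [M.ι_mul]
    rw [Finset.sum_ite_eq, if_pos hi]
  map_star' a := by simp only [star_sum, M.star_ι]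

theorem blockHom_apply (m : ℕ) (b : B) : M.blockHom m b = ∑ k ∈ Finset.range m, M.ι k k b := rfl

theorem norm_blockHom_le (m : ℕ) (b : B) : ‖M.blockHom m b‖ ≤ ‖b‖ :=
  NonUnitalStarAlgHom.norm_apply_le _ _

theorem blockHom_mul_ι {m i : ℕ} (hi : i < m) (j : ℕ) (a b : B) :
    M.blockHom m a * M.ι i j b = M.ι i j (a * b) := by
  rw [blockHom_apply, Finset.sum_mul]
  simp only [M.ι_mul]
  rw [Finset.sum_ite_eq', if_pos (Finset.mem_range.2 hi)]

theorem ι_mul_blockHom {m j : ℕ} (hj : j < m) (i : ℕ) (a b : B) :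
    M.ι i j a * M.blockHom m b = M.ι i j (a * b) := by
  rw [blockHom_apply, Finset.mul_sum]
  simp only [M.ι_mul]
  rw [Finset.sum_ite_eq, if_pos (Finset.mem_range.2 hj)]

/-- The elements `u ⊗ (e_{00} + ⋯ + e_{m-1,m-1})`, with `u` in an approximate unit of `B`, form an
approximate unit of `E`. -/
theorem tendsto_blockHom_mul {l : Filter B} (hl : ∀ᶠ u in l, ‖u‖ ≤ 1)
    (hu : ∀ b : B, Tendsto (fun u => u * b) l (𝓝 b)) (c : E) :
    Tendsto (fun p : ℕ × B => M.blockHom p.1 p.2 * c) (atTop ×ˢ l) (𝓝 c) := by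
  have hb : ∀ᶠ p : ℕ × B in atTop ×ˢ l, ‖M.blockHom p.1 p.2‖ ≤ 1 := by
    filter_upwards [tendsto_snd.eventually hl] with p hp
    exact (M.norm_blockHom_le _ _).trans hp
  induction c using M.induction with
  | hp =>
    refine isClosed_of_closure_subset fun c hc => Metric.tendsto_nhds.2 fun ε hε => ?_
    obtain ⟨d, hd, hcd⟩ := Metric.mem_closure_iff.1 hc (ε / 3) (by positivity)
    filter_upwards [(Metric.tendsto_nhds.1 hd) (ε / 3) (by positivity), hb] with p hp hp1
    rw [dist_eq_norm] at *
    have h1 : M.blockHom p.1 p.2 * c - c =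
        M.blockHom p.1 p.2 * (c - d) + (M.blockHom p.1 p.2 * d - d) - (c - d) := by
      noncomm_ring
    have h2 : ‖M.blockHom p.1 p.2 * (c - d)‖ ≤ ‖c - d‖ :=
      (norm_mul_le _ _).trans (mul_le_of_le_one_left (norm_nonneg _) hp1)
    rw [h1]
    have h3 := norm_sub_le (M.blockHom p.1 p.2 * (c - d) + (M.blockHom p.1 p.2 * d - d)) (c - d)
    have h4 := norm_add_le (M.blockHom p.1 p.2 * (c - d)) (M.blockHom p.1 p.2 * d - d)
    linarith
  | zero => simpa using tendsto_const_nhds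
  | add c d hc hd => simpa only [mul_add] using hc.add hd
  | gen i j b =>
    have h := ((M.continuous_ι i j).tendsto b).comp ((hu b).comp (tendsto_snd (f := atTop (α := ℕ))))
    refine h.congr' ?_
    filter_upwards [tendsto_fst.eventually (eventually_gt_atTop i)] with p hp
    exact (M.blockHom_mul_ι hp j p.2 b).symm

/-! ### Matrix entries -/

/-- `b` is the `(i, j)`-entry of `c`, that is, `(x ⊗ e_{0i}) c (y ⊗ e_{j0}) = x b y ⊗ e_{00}` for
all `x` and `y`. -/
def IsEntry (i j : ℕ) (c : E) (b : B) : Prop :=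
  ∀ x y : B, M.ι 0 i x * c * M.ι j 0 y = M.ι 0 0 (x * b * y)

variable {M}

namespace IsEntry
variable {i j : ℕ} {c d : E} {a b : B}

theorem norm_le (h : M.IsEntry i j c b) : ‖b‖ ≤ ‖c‖ := by
  rcases (norm_nonneg b).eq_or_lt with hb | hb
  · rw [← hb]; exact norm_nonneg _
  -- Take `x = y = b*` in the definition of `IsEntry`.
  have h1 : ‖star b * b * star b‖ ≤ ‖b‖ * ‖c‖ * ‖b‖ := by
    rw [← M.norm_ι 0 0, ← h]
    refine (norm_mul_le _ _).trans (mul_le_mul ((norm_mul_le _ _).trans ?_) ?_ (by positivity)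
      (by positivity))
    · rw [M.norm_ι, norm_star]
    · rw [M.norm_ι, norm_star]
  have h2 : ‖b‖ * ‖b‖ * (‖b‖ * ‖b‖) ≤ ‖star b * b * star b‖ * ‖b‖ := by
    refine le_trans (le_of_eq ?_) (norm_mul_le _ _)
    have := CStarRing.norm_star_mul_self (x := star b * b)
    rw [star_mul, star_star, CStarRing.norm_star_mul_self] at this
    rw [← this, mul_assoc (star b * b)]
  have h3 : ‖b‖ * (‖b‖ * ‖b‖ * ‖b‖) ≤ ‖c‖ * (‖b‖ * ‖b‖ * ‖b‖) := by nlinarith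
  exact le_of_mul_le_mul_right h3 (by positivity)

theorem zero : M.IsEntry i j 0 0 := fun x y => by simp

theorem add (hc : M.IsEntry i j c a) (hd : M.IsEntry i j d b) : M.IsEntry i j (c + d) (a + b) :=
  fun x y => by simp only [mul_add, add_mul, map_add, hc x y, hd x y]

theorem smul (hc : M.IsEntry i j c a) (z : ℂ) : M.IsEntry i j (z • c) (z • a) :=
  fun x y => by simp only [mul_smul_comm, smul_mul_assoc, map_smul, hc x y]

theorem sub (hc : M.IsEntry i j c a) (hd : M.IsEntry i j d b) : M.IsEntry i j (c - d) (a - b) :=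
  fun x y => by simp only [mul_sub, sub_mul, map_sub, hc x y, hd x y]

theorem unique (h : M.IsEntry i j c a) (h' : M.IsEntry i j c b) : a = b := by
  have := (h.sub h').norm_le
  rw [sub_self, norm_zero] at this
  exact sub_eq_zero.1 (norm_le_zero_iff.1 this)

theorem gen (i j k l : ℕ) (b : B) :
    M.IsEntry i j (M.ι k l b) (if k = i ∧ l = j then b else 0) := by
  intro x y
  rw [M.ι_mul]
  by_cases hk : k = i
  · subst hk
    rw [if_pos rfl, M.ι_mul]
    by_cases hl : l = j <;> simp [hl]
  · rw [if_neg (Ne.symm hk)]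
    simp [hk]

end IsEntry

variable (M)

/-- Every element has entries: they exist on a dense set, and the entry map is contractive. -/
theorem exists_isEntry (i j : ℕ) (c : E) : ∃ b, M.IsEntry i j c b := by
  induction c using M.induction with
  | hp =>
    refine isClosed_of_closure_subset fun c hc => ?_
    obtain ⟨f, hf, hfc⟩ := mem_closure_iff_seq_limit.1 hc
    choose g hg using hf
    have hcau : CauchySeq g := by
      rw [Metric.cauchySeq_iff]
      intro ε hε
      obtain ⟨N, hN⟩ := (Metric.cauchySeq_iff.1 hfc.cauchySeq) ε hε
      refine ⟨N, fun m hm n hn => ?_⟩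
      refine lt_of_le_of_lt ?_ (hN m hm n hn)
      rw [dist_eq_norm, dist_eq_norm]
      exact ((hg m).sub (hg n)).norm_le
    obtain ⟨b, hb⟩ := cauchySeq_tendsto_of_complete hcau
    refine ⟨b, fun x y => ?_⟩
    have h1 : Tendsto (fun n => M.ι 0 i x * f n * M.ι j 0 y) atTop
        (𝓝 (M.ι 0 i x * c * M.ι j 0 y)) := (hfc.const_mul _).mul_const _
    have h2 : Tendsto (fun n => M.ι 0 0 (x * g n * y)) atTop (𝓝 (M.ι 0 0 (x * b * y))) :=
      ((M.continuous_ι 0 0).tendsto _).comp ((hb.const_mul _).mul_const _)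
    refine tendsto_nhds_unique h1 (h2.congr fun n => ?_)
    rw [hg n x y]
  | zero => exact ⟨0, IsEntry.zero⟩
  | add c d hc hd =>
    obtain ⟨a, ha⟩ := hc
    obtain ⟨b, hb⟩ := hd
    exact ⟨a + b, ha.add hb⟩
  | gen k l b => exact ⟨_, IsEntry.gen i j k l b⟩

/-- The `(i, j)`-entry of an element of `E`. -/
def entry (i j : ℕ) : E →L[ℂ] B :=
  have spec := fun c => (M.exists_isEntry i j c).choose_spec
  LinearMap.mkContinuous
    { toFun := fun c => (M.exists_isEntry i j c).choose
      map_add' := fun c d => (spec (c + d)).unique ((spec c).add (spec d))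
      map_smul' := fun z c => (spec (z • c)).unique ((spec c).smul z) } 1
    fun c => by
      rw [one_mul]
      exact (spec c).norm_le

theorem isEntry_entry (i j : ℕ) (c : E) : M.IsEntry i j c (M.entry i j c) :=
  (M.exists_isEntry i j c).choose_spec

theorem norm_entry_le (i j : ℕ) (c : E) : ‖M.entry i j c‖ ≤ ‖c‖ := (M.isEntry_entry i j c).norm_le

theorem entry_ι (i j k l : ℕ) (b : B) :
    M.entry i j (M.ι k l b) = if k = i ∧ l = j then b else 0 :=
  (M.isEntry_entry i j _).unique (IsEntry.gen i j k l b)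

theorem ι_mul_mul_ι (k i j l : ℕ) (x y : B) (c : E) :
    M.ι k i x * c * M.ι j l y = M.ι k l (x * M.entry i j c * y) := by
  induction c using M.induction with
  | hp =>
    refine isClosed_eq (by fun_prop) ((M.continuous_ι k l).comp (by fun_prop))
  | zero => simp
  | add c d hc hd => simp only [mul_add, add_mul, map_add, hc, hd]
  | gen p q b =>
    rw [M.ι_mul, M.entry_ι]
    by_cases hp : p = i
    · subst hp
      rw [if_pos rfl, M.ι_mul]
      by_cases hq : q = j <;> simp [hq]
    · rw [if_neg (Ne.symm hp)]
      simp [hp]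

theorem entry_star (i j : ℕ) (c : E) : M.entry i j (star c) = star (M.entry j i c) := by
  induction c using M.induction with
  | hp => exact isClosed_eq (by fun_prop) (by fun_prop)
  | zero => simp
  | add c d hc hd => simp only [star_add, map_add, hc, hd]
  | gen p q b =>
    rw [M.star_ι, M.entry_ι, M.entry_ι]
    by_cases hp : p = j <;> by_cases hq : q = i <;> simp [hp, hq]

theorem entry_mul_ι (i j : ℕ) (c : E) (b : B) :
    M.entry i j (c * M.ι j j b) = M.entry i j c * b := by
  induction c using M.induction with
  | hp => exact isClosed_eq (by fun_prop) (by fun_prop)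
  | zero => simp
  | add c d hc hd => simp only [add_mul, map_add, hc, hd]
  | gen p q a =>
    rw [M.ι_mul, M.entry_ι]
    by_cases hq : q = j
    · rw [if_pos hq, M.entry_ι]
      by_cases hp : p = i <;> simp [hp, hq]
    · simp [hq]

theorem entry_ι_mul (i j : ℕ) (c : E) (b : B) :
    M.entry i j (M.ι i i b * c) = b * M.entry i j c := by
  have := M.entry_mul_ι j i (star c) (star b)
  rw [← M.star_ι, ← star_mul, M.entry_star, M.entry_star, ← star_mul, star_inj] at this
  exact this

theorem entry_mul_ι_mul (i j k l : ℕ) (c d : E) (b : B) :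
    M.entry i j (c * M.ι k l b * d) = M.entry i k c * b * M.entry l j d := by
  induction c using M.induction with
  | hp => exact isClosed_eq (by fun_prop) (by fun_prop)
  | zero => simp
  | add c d hc hd => simp only [add_mul, map_add, hc, hd]
  | gen p q x =>
    induction d using M.induction with
    | hp => exact isClosed_eq (by fun_prop) (by fun_prop)
    | zero => simp
    | add c d hc hd => simp only [mul_add, map_add, hc, hd]
    | gen r s y =>
      rw [M.ι_mul, M.entry_ι, M.entry_ι]
      by_cases hq : q = k
      · rw [if_pos hq, M.ι_mul]
        by_cases hr : r = l
        · rw [if_pos hr.symm, M.entry_ι]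
          by_cases hp : p = i <;> by_cases hs : s = j <;> simp [hp, hq, hr, hs]
        · rw [if_neg (Ne.symm hr)]
          simp [hr]
      · simp [hq]

theorem entry_star_mul_blockHom_mul (i m : ℕ) (c : E) (u : B) :
    M.entry i i (star c * M.blockHom m u * c) =
      ∑ k ∈ Finset.range m, star (M.entry k i c) * u * M.entry k i c := by
  rw [blockHom_apply, Finset.mul_sum, Finset.sum_mul, map_sum]
  refine Finset.sum_congr rfl fun k _ => ?_
  rw [M.entry_mul_ι_mul, M.entry_star]

/-- The diagonal entries of `c* c`, as limits of those of `c* (u ⊗ (e_{00} + ⋯ + e_{m-1,m-1})) c`. -/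
theorem tendsto_entry {l : Filter B} (hl : ∀ᶠ u in l, ‖u‖ ≤ 1)
    (hu : ∀ b : B, Tendsto (fun u => u * b) l (𝓝 b)) (i : ℕ) (c : E) :
    Tendsto (fun p : ℕ × B =>
      ∑ k ∈ Finset.range p.1, star (M.entry k i c) * p.2 * M.entry k i c) (atTop ×ˢ l)
      (𝓝 (M.entry i i (star c * c))) := by
  have h := ((M.entry i i).continuous.tendsto _).comp
    ((M.tendsto_blockHom_mul hl hu c).const_mul (star c))
  refine h.congr fun p => ?_
  rw [Function.comp_apply, ← mul_assoc, entry_star_mul_blockHom_mul]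

theorem isPos_entry {d : E} (hd : IsPos d) (i : ℕ) : IsPos (M.entry i i d) := by
  obtain ⟨c, rfl⟩ := hd
  obtain ⟨l, hl, hu, hb⟩ := exists_approximateUnit B
  refine isClosed_isPos.mem_of_tendsto (M.tendsto_entry (hu.mono fun u h => h.2) hb i c) ?_
  filter_upwards [tendsto_snd.eventually hu] with p hp
  exact IsPos.sum fun k _ => hp.1.star_left_conjugate _

/-- `∑_{k < m} (c_{ki})* c_{ki} ≤ (c* c)_{ii}`. -/
theorem isPos_entry_sub_sum (i m : ℕ) (c : E) :
    IsPos (M.entry i i (star c * c) -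
      ∑ k ∈ Finset.range m, star (M.entry k i c) * M.entry k i c) := by
  obtain ⟨l, hl, hu, hb⟩ := exists_approximateUnit B
  have h1 : Tendsto (fun u : B => M.entry i i (star c * c) -
      ∑ k ∈ Finset.range m, star (M.entry k i c) * u * M.entry k i c) l
      (𝓝 (M.entry i i (star c * c) -
      ∑ k ∈ Finset.range m, star (M.entry k i c) * M.entry k i c)) := by
    refine tendsto_const_nhds.sub (tendsto_finsetSum _ fun k _ => ?_)
    simp only [mul_assoc]
    exact (hb _).const_mul _
  refine isClosed_isPos.mem_of_tendsto h1 ?_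
  filter_upwards [hu] with u hu
  have h2 := isPos_norm_smul_sub_conjugate (hu.1.map (M.blockHom m)).isSelfAdjoint
    ((M.norm_blockHom_le m u).trans hu.2) c
  have h3 := M.isPos_entry h2 i
  rwa [map_sub, entry_star_mul_blockHom_mul, Complex.ofReal_one, one_smul] at h3

/-! ### Extension of traces -/

/-- The extension of a trace on `B` to `E`: the sum of its values on the diagonal entries. -/
def extendTrace (τ : B → ℝ≥0∞) (c : E) : ℝ≥0∞ := ∑' i, τ (M.entry i i c)

theorem extendTrace_ι {τ : B → ℝ≥0∞} (hτ : τ 0 = 0) (b : B) :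
    M.extendTrace τ (M.ι 0 0 b) = τ b := by
  rw [extendTrace, tsum_eq_single 0]
  · simp [M.entry_ι]
  · intro i hi
    simp [M.entry_ι, hi.symm, hτ]

/-- The expansion of `τ((c* c)_{ii})`. This is the point where lower semicontinuity of `τ` is
needed. -/
theorem trace_entry_star_mul {τ : B → ℝ≥0∞} (hτ : IsLscTrace τ) (i : ℕ) (c : E) :
    τ (M.entry i i (star c * c)) = ∑' k, τ (star (M.entry k i c) * M.entry k i c) := by
  refine le_antisymm (le_of_forall_lt fun a ha => ?_) ?_
  · obtain ⟨l, hl, hu, hb⟩ := exists_approximateUnit B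
    have h1 := hτ.lowerSemicontinuousOn _ (M.isPos_entry (isPos_star_mul_self c) i) a ha
    have h2 : ∀ᶠ p : ℕ × B in atTop ×ˢ l, IsPos p.2 ∧ ‖p.2‖ ≤ 1 := tendsto_snd.eventually hu
    have h3 := (tendsto_nhdsWithin_iff.2 ⟨M.tendsto_entry (hu.mono fun u h => h.2) hb i c,
      h2.mono fun p hp => IsPos.sum fun k _ => hp.1.star_left_conjugate _⟩).eventually h1
    obtain ⟨p, h4, h5⟩ := (h3.and h2).exists
    refine h4.trans_le ?_
    rw [hτ.map_sum fun k _ => h5.1.star_left_conjugate _]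
    refine le_trans (Finset.sum_le_sum fun k _ => ?_) (ENNReal.sum_le_tsum _)
    refine hτ.mono (h5.1.star_left_conjugate _) ?_
    have := isPos_norm_smul_sub_conjugate h5.1.isSelfAdjoint h5.2 (M.entry k i c)
    rwa [Complex.ofReal_one, one_smul] at this
  · rw [ENNReal.tsum_eq_iSup_nat]
    refine iSup_le fun m => ?_
    rw [← hτ.map_sum fun k _ => isPos_star_mul_self _]
    exact hτ.mono (IsPos.sum fun k _ => isPos_star_mul_self _) (M.isPos_entry_sub_sum i m c)

/-- The trace property holds because, by `trace_entry_star_mul`, the values at `c* c` and `c c*` are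
the double sums of `τ((c_{ki})* c_{ki})` and of `τ(c_{ki} (c_{ki})*)`. -/
theorem isLscTrace_extendTrace {τ : B → ℝ≥0∞} (hτ : IsLscTrace τ) :
    IsLscTrace (M.extendTrace τ) where
  map_zero := by simp [extendTrace, hτ.map_zero]
  map_combination s t a b hs ht ha hb := by
    simp only [extendTrace, map_add, map_smul]
    rw [← ENNReal.tsum_mul_left, ← ENNReal.tsum_mul_left, ← ENNReal.tsum_add]
    exact tsum_congr fun i => hτ.map_combination s t _ _ hs ht (M.isPos_entry ha i)
      (M.isPos_entry hb i)
  map_star_mul_self c := by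
    have h := fun i => M.trace_entry_star_mul hτ i c
    have h' := fun i => M.trace_entry_star_mul hτ i (star c)
    simp only [star_star] at h'
    simp only [extendTrace, h, h']
    rw [ENNReal.tsum_comm]
    refine tsum_congr fun k => tsum_congr fun i => ?_
    rw [M.entry_star, star_star, hτ.map_star_mul_self]
  lowerSemicontinuousOn := by
    refine lowerSemicontinuousOn_tsum fun i => ?_
    exact hτ.lowerSemicontinuousOn.comp (M.entry i i).continuous.continuousOn
      fun c hc => M.isPos_entry hc i

end MatrixSystem

/-! ### Central sequences in `B` and in `E` -/

section Quot
variable {X Y : Type*} [NonUnitalCStarAlgebra X] [NonUnitalCStarAlgebra Y]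

/-- A total relation which is compatible with the `*`-algebra operations and with ideals induces a
`*`-homomorphism between the quotients. -/
theorem ClosedIdeal.exists_hom_of_rel (I : ClosedIdeal X) (J : ClosedIdeal Y) (R : X → Y → Prop)
    (total : ∀ x, ∃ y, R x y) (add : ∀ x y x' y', R x y → R x' y' → R (x + x') (y + y'))
    (smul : ∀ (c : ℂ) x y, R x y → R (c • x) (c • y))
    (mul : ∀ x y x' y', R x y → R x' y' → R (x * x') (y * y'))
    (star : ∀ x y, R x y → R (star x) (star y))
    (ker : ∀ x y, R x y → x ∈ I.toSubmodule → y ∈ J.toSubmodule) :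
    ∃ f : I.Quot →⋆ₙₐ[ℂ] J.Quot, ∀ x y, R x y → f (I.proj x) = J.proj y := by
  choose t ht using total
  choose s hs using I.proj_surjective
  have key : ∀ x y q, R x y → I.proj x = q → J.proj (t (s q)) = J.proj y := by
    intro x y q h hq
    rw [← hs q, I.proj_eq_proj] at hq
    rw [eq_comm, J.proj_eq_proj]
    refine ker (x - s q) _ ?_ hq
    have := add _ _ _ _ h (smul (-1) _ _ (ht (s q)))
    rwa [neg_one_smul, neg_one_smul, ← sub_eq_add_neg, ← sub_eq_add_neg] at this
  refine ⟨{ toFun := fun q => J.proj (t (s q))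
            map_smul' := fun c q => ?_
            map_zero' := ?_
            map_add' := fun p q => ?_
            map_mul' := fun p q => ?_
            map_star' := fun q => ?_ }, fun x y h => key x y _ h rfl⟩
  · rw [key _ _ (c • q) (smul c _ _ (ht (s q))) (by rw [map_smul, hs]), map_smul]
    rfl
  · have h := smul 0 _ _ (ht 0)
    rw [zero_smul, zero_smul] at h
    rw [key _ _ 0 h (map_zero _), map_zero]
  · rw [key _ _ (p + q) (add _ _ _ _ (ht (s p)) (ht (s q))) (by rw [map_add, hs, hs]), map_add]
  · rw [key _ _ (p * q) (mul _ _ _ _ (ht (s p)) (ht (s q))) (by rw [proj_mul, hs, hs]), proj_mul]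
  · rw [key _ _ (Star.star q) (star _ _ (ht (s q))) (by rw [proj_star, hs]), proj_star]

end Quot

section RelCommutant
variable {A : Type*} [NonUnitalCStarAlgebra A] {ω : Ultrafilter ℕ}

theorem star_diag (a : A) : star (diag ω a) = diag ω (star a) :=
  (map_star (diagHom ω) a).symm

theorem diag_mul (a b : A) : diag ω (a * b) = diag ω a * diag ω b := map_mul (diagHom ω) a b

theorem mem_relCommutant_iff {x : Ultrapower ω A} :
    x ∈ RelCommutant ω A ↔ ∀ a, diag ω a * x = x * diag ω a := by
  refine ⟨fun h a => h _ (Or.inl ⟨a, rfl⟩), fun h g hg => ?_⟩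
  rcases hg with ⟨a, rfl⟩ | ⟨a, ha⟩
  · exact h a
  · have : g = diag ω (star a) := by rw [← star_diag, ha, star_star]
    rw [this]
    exact h _

theorem diag_mul_comm (x : RelCommutant ω A) (a : A) :
    diag ω a * (x : Ultrapower ω A) = x * diag ω a := mem_relCommutant_iff.1 x.2 a

/-- Products of commuting positive elements are positive. -/
theorem isPos_diag_mul {a : A} (ha : IsPos a) {x : RelCommutant ω A} (hx : IsPos x) :
    IsPos (diag ω a * (x : Ultrapower ω A)) := by
  obtain ⟨r, rfl⟩ := ha
  obtain ⟨s, rfl⟩ := hx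
  refine ⟨diag ω r * s, ?_⟩
  have h := diag_mul_comm (star s) (star r * r)
  change diag ω (star r * r) * (((star s : RelCommutant ω A) : Ultrapower ω A) * s) = _
  rw [← mul_assoc, h, star_mul, star_diag, diag_mul]
  simp only [mul_assoc]
  rfl

end RelCommutant

namespace MatrixSystem
variable {B E : Type*} [NonUnitalCStarAlgebra B] [NonUnitalCStarAlgebra E] (M : MatrixSystem B E)
variable {ω : Ultrafilter ℕ}

/-- The elements `x ∈ B_ω ∩ B'` and `y ∈ E_ω ∩ E'` correspond to each other if `y` acts on the
corner `B ⊗ e_{00}` of `E` as `x ⊗ e_{00}`. -/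
def Related (x : RelCommutant ω B) (y : RelCommutant ω E) : Prop :=
  ∀ b : B, (y : Ultrapower ω E) * diag ω (M.ι 0 0 b) =
    mapUltra ω (M.hom 0) ((x : Ultrapower ω B) * diag ω b)

namespace Related
variable {M} {x x' : RelCommutant ω B} {y y' : RelCommutant ω E}

theorem diag_mul (h : M.Related x y) (b : B) : diag ω (M.ι 0 0 b) * (y : Ultrapower ω E) =
    mapUltra ω (M.hom 0) (diag ω b * (x : Ultrapower ω B)) := by
  rw [diag_mul_comm, diag_mul_comm, h]

theorem add (h : M.Related x y) (h' : M.Related x' y') : M.Related (x + x') (y + y') := fun b => by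
  rw [NonUnitalStarSubalgebra.coe_add, NonUnitalStarSubalgebra.coe_add, add_mul, add_mul, h, h',
    map_add]

theorem smul (h : M.Related x y) (c : ℂ) : M.Related (c • x) (c • y) := fun b => by
  rw [NonUnitalStarSubalgebra.coe_smul, NonUnitalStarSubalgebra.coe_smul, smul_mul_assoc,
    smul_mul_assoc, h, map_smul]

theorem mul (h : M.Related x y) (h' : M.Related x' y') : M.Related (x * x') (y * y') := fun b => by
  rw [NonUnitalStarSubalgebra.coe_mul, NonUnitalStarSubalgebra.coe_mul, mul_assoc, h', mul_assoc,
    ← diag_mul_comm x', map_mul, mapUltra_diag, ← mul_assoc, hom_apply, h, ← map_mul, mul_assoc]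

theorem star (h : M.Related x y) : M.Related (star x) (star y) := fun b => by
  have h1 := congrArg Star.star (h.diag_mul (Star.star b))
  rw [star_mul, star_diag, M.star_ι, star_star, ← map_star, star_mul, star_diag, star_star] at h1
  exact h1

theorem congr_right (h : M.Related x y) (hy : (annIdeal ω E).proj y = (annIdeal ω E).proj y') :
    M.Related x y' := fun b => by
  rw [ClosedIdeal.proj_eq_proj] at hy
  have := (hy (M.ι 0 0 b)).1
  rw [NonUnitalStarSubalgebra.coe_sub, sub_mul, sub_eq_zero] at this
  rw [← this, h]

theorem congr_left (h : M.Related x y) (hx : (annIdeal ω B).proj x = (annIdeal ω B).proj x') :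
    M.Related x' y := fun b => by
  rw [ClosedIdeal.proj_eq_proj] at hx
  have := (hx b).1
  rw [NonUnitalStarSubalgebra.coe_sub, sub_mul, sub_eq_zero] at this
  rw [← this, h]

theorem mem_annIdeal_left (h : M.Related x y) (hy : y ∈ (annIdeal ω E).toSubmodule) :
    x ∈ (annIdeal ω B).toSubmodule := by
  intro b
  have h1 := h b
  rw [(hy _).1, eq_comm, map_eq_zero_iff _ (mapUltra_injective ω (M.hom_injective 0))] at h1
  exact ⟨h1, by rw [diag_mul_comm, h1]⟩

/-- If `y` annihilates the corner `B ⊗ e_{00}`, it annihilates `E`: elements `u v b ⊗ e_{ij}` factor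
as `(u ⊗ e_{i0}) (v ⊗ e_{00}) (b ⊗ e_{0j})`, and `y` commutes with the first factor. -/
theorem mem_annIdeal_right (h : M.Related x y) (hx : x ∈ (annIdeal ω B).toSubmodule) :
    y ∈ (annIdeal ω E).toSubmodule := by
  have h1 : ∀ b, (y : Ultrapower ω E) * diag ω (M.ι 0 0 b) = 0 := fun b => by
    rw [h, (hx b).1, map_zero]
  suffices h2 : ∀ c : E, (y : Ultrapower ω E) * diag ω c = 0 from
    fun c => ⟨h2 c, by rw [diag_mul_comm, h2]⟩
  intro c
  induction c using M.induction with
  | hp => exact isClosed_eq (continuous_const.mul (continuous_diag ω)) continuous_const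
  | zero => rw [← diagHom_apply, map_zero, mul_zero]
  | add c d hc hd =>
    simp only [← diagHom_apply] at *
    rw [map_add, mul_add, hc, hd, add_zero]
  | gen i j b =>
    have hcl : IsClosed {b | (y : Ultrapower ω E) * diag ω (M.ι i j b) = 0} :=
      isClosed_eq (continuous_const.mul ((continuous_diag ω).comp (M.continuous_ι i j)))
        continuous_const
    have h3 : ∀ u v b : B, (y : Ultrapower ω E) * diag ω (M.ι i j (u * (v * b))) = 0 := by
      intro u v b
      rw [← M.ι_mul_self i 0 j, ← M.ι_mul_self 0 0 j, StabilisedGamma.diag_mul,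
        StabilisedGamma.diag_mul, ← mul_assoc, ← diag_mul_comm, mul_assoc,
        ← mul_assoc (y : Ultrapower ω E), h1, zero_mul, mul_zero]
    obtain ⟨l, hl, hu, hb⟩ := exists_approximateUnit B
    refine hcl.mem_of_tendsto (hb b) (Eventually.of_forall fun u => ?_)
    exact hcl.mem_of_tendsto ((hb b).const_mul u) (Eventually.of_forall fun v => h3 u v b)

end Related

/-- Given `x = (x_n)`, take for `y` the sequence `x_n ⊗ (e_{00} + ⋯ + e_{n-1,n-1})`. It commutes with
`b ⊗ e_{ij}` asymptotically, as `i, j < n` for almost all `n`. This needs `ω` to be free. -/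
theorem exists_related_right (hω : (ω : Filter ℕ) ≤ cofinite) (x : RelCommutant ω B) :
    ∃ y, M.Related x y := by
  obtain ⟨x, hx⟩ := x
  obtain ⟨ξ, rfl⟩ := (nullIdeal ω B).proj_surjective x
  have hgt : ∀ m, ∀ᶠ n in (ω : Filter ℕ), m < n := fun m =>
    hω (Nat.cofinite_eq_atTop ▸ eventually_gt_atTop m)
  let η : BddSeq E := mkSeq (fun n => M.blockHom n (ξ n)) ‖ξ‖ fun n =>
    (M.norm_blockHom_le n _).trans (norm_seq_apply_le ξ n)
  refine ⟨⟨(nullIdeal ω E).proj η, mem_relCommutant_iff.2 fun c => ?_⟩, fun b => ?_⟩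
  · induction c using M.induction with
    | hp =>
      have h := continuous_diag ω (A := E)
      exact isClosed_eq (h.mul continuous_const) (continuous_const.mul h)
    | zero => rw [← diagHom_apply, map_zero, mul_zero, zero_mul]
    | add c d hc hd =>
      simp only [← diagHom_apply] at *
      rw [map_add, mul_add, add_mul, hc, hd]
    | gen i j b =>
      have h := mem_relCommutant_iff.1 hx b
      refine (proj_eq_proj_iff_tendsto ω
        (x := constSeq (M.ι i j b) * η) (y := η * constSeq (M.ι i j b))).2 ?_
      have h' := (proj_eq_proj_iff_tendsto ω (x := constSeq b * ξ) (y := ξ * constSeq b)).1 h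
      refine h'.congr' ?_
      filter_upwards [hgt i, hgt j] with n hi hj
      change ‖b * ξ n - ξ n * b‖ =
        ‖M.ι i j b * M.blockHom n (ξ n) - M.blockHom n (ξ n) * M.ι i j b‖
      rw [M.ι_mul_blockHom hj, M.blockHom_mul_ι hi, ← map_sub, M.norm_ι]
  · refine proj_eq_proj_of_eventually ω
      (x := η * constSeq (M.ι 0 0 b)) (y := mapSeq (M.hom 0) (ξ * constSeq b)) ?_
    filter_upwards [hgt 0] with n hn
    exact M.blockHom_mul_ι hn 0 (ξ n) b

/-- Given `y = (y_n)`, take for `x` the sequence of the `(0, 0)`-entries of the `y_n`. -/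
theorem exists_related_left (y : RelCommutant ω E) : ∃ x, M.Related x y := by
  obtain ⟨y, hy⟩ := y
  have hy' := mem_relCommutant_iff.1 hy
  obtain ⟨η, rfl⟩ := (nullIdeal ω E).proj_surjective y
  let ξ : BddSeq B := mkSeq (fun n => M.entry 0 0 (η n)) ‖η‖ fun n =>
    (M.norm_entry_le 0 0 _).trans (norm_seq_apply_le η n)
  have hx : ∀ b, diag ω b * (nullIdeal ω B).proj ξ = (nullIdeal ω B).proj ξ * diag ω b := fun b => by
    refine (proj_eq_proj_iff_tendsto ω (x := constSeq b * ξ) (y := ξ * constSeq b)).2 ?_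
    refine squeeze_zero (fun n => norm_nonneg _) (fun n => ?_)
      ((proj_eq_proj_iff_tendsto ω (x := constSeq (M.ι 0 0 b) * η)
        (y := η * constSeq (M.ι 0 0 b))).1 (hy' (M.ι 0 0 b)))
    change ‖b * M.entry 0 0 (η n) - M.entry 0 0 (η n) * b‖ ≤
      ‖M.ι 0 0 b * η n - η n * M.ι 0 0 b‖
    rw [← M.entry_ι_mul, ← M.entry_mul_ι, ← map_sub]
    exact M.norm_entry_le 0 0 _
  refine ⟨⟨(nullIdeal ω B).proj ξ, mem_relCommutant_iff.2 hx⟩, fun b => ?_⟩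
  have hcl : IsClosed {b | (nullIdeal ω E).proj η * diag ω (M.ι 0 0 b) =
      mapUltra ω (M.hom 0) ((nullIdeal ω B).proj ξ * diag ω b)} := by
    simp only [map_mul, mapUltra_diag, hom_apply]
    have := (continuous_diag ω).comp (M.continuous_ι 0 0)
    exact isClosed_eq (continuous_const.mul this) (continuous_const.mul this)
  -- By continuity `b` may be replaced by `u b`; then `y (u b ⊗ e_{00}) = (u ⊗ e_{00}) y (b ⊗ e_{00})`
  -- picks out the `(0, 0)`-entries.
  obtain ⟨l, hl, hu, hb⟩ := exists_approximateUnit B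
  refine hcl.mem_of_tendsto (hb b) (Eventually.of_forall fun u => ?_)
  have h1 : diag ω (M.ι 0 0 u) * (nullIdeal ω E).proj η * diag ω (M.ι 0 0 b) =
      mapUltra ω (M.hom 0) (diag ω u * (nullIdeal ω B).proj ξ * diag ω b) := by
    refine proj_eq_proj_of_eventually ω
      (x := constSeq (M.ι 0 0 u) * η * constSeq (M.ι 0 0 b))
      (y := mapSeq (M.hom 0) (constSeq u * ξ * constSeq b)) (Eventually.of_forall fun n => ?_)
    exact M.ι_mul_mul_ι 0 0 0 0 u b (η n)
  change (nullIdeal ω E).proj η * diag ω (M.ι 0 0 (u * b)) = _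
  rw [← M.ι_mul_self 0 0 0, diag_mul, ← mul_assoc, ← hy', h1, hx, diag_mul, mul_assoc]

/-- The `*`-homomorphism `F_ω(B) → F_ω(E)` induced by the relation. -/
theorem exists_hom_right (hω : (ω : Filter ℕ) ≤ cofinite) :
    ∃ f : CentralSeqAlgebra ω B →⋆ₙₐ[ℂ] CentralSeqAlgebra ω E, ∀ x y, M.Related x y →
      f ((annIdeal ω B).proj x) = (annIdeal ω E).proj y :=
  ClosedIdeal.exists_hom_of_rel _ _ M.Related (M.exists_related_right hω)
    (fun _ _ _ _ h h' => h.add h') (fun c _ _ h => h.smul c) (fun _ _ _ _ h h' => h.mul h')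
    (fun _ _ h => h.star) fun _ _ h => h.mem_annIdeal_right

/-- The `*`-homomorphism `F_ω(E) → F_ω(B)` induced by the relation. -/
theorem exists_hom_left :
    ∃ f : CentralSeqAlgebra ω E →⋆ₙₐ[ℂ] CentralSeqAlgebra ω B, ∀ x y, M.Related x y →
      f ((annIdeal ω E).proj y) = (annIdeal ω B).proj x := by
  obtain ⟨f, hf⟩ := ClosedIdeal.exists_hom_of_rel (annIdeal ω E) (annIdeal ω B)
    (fun y x => M.Related x y) M.exists_related_left
    (fun _ _ _ _ h h' => h.add h') (fun c _ _ h => h.smul c) (fun _ _ _ _ h h' => h.mul h')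
    (fun _ _ h => h.star) fun _ _ h => h.mem_annIdeal_left
  exact ⟨f, fun x y h => hf y x h⟩

end MatrixSystem

/-! ### Transfer of stabilised property `Γ` -/

namespace MatrixSystem
variable {B E : Type*} [NonUnitalCStarAlgebra B] [NonUnitalCStarAlgebra E] (M : MatrixSystem B E)
variable {ω : Ultrafilter ℕ}

/-- The trace of `r* (u ⊗ e_{kk}) r` can be computed in the corner `B ⊗ e_{00}`: this element is
`v* v` for `v = (u^{1/2} ⊗ e_{0k}) r`, and `v v*` lies in the corner. The same goes for the product
with a positive `y` in the relative commutant, by the trace property for `v y^{1/2}`. -/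
theorem exists_trace_conjugate_eq {τ : Ultrapower ω E → ℝ≥0∞} (hτ : IsTrace τ) {u : B}
    (hu : IsPos u) (k : ℕ) (r : E) : ∃ b : B, IsPos b ∧
      τ (diag ω (star r * M.ι k k u * r)) = τ (diag ω (M.ι 0 0 b)) ∧
      ∀ y : RelCommutant ω E, IsPos y →
        IsPos (diag ω (star r * M.ι k k u * r) * (y : Ultrapower ω E)) ∧
        τ (diag ω (star r * M.ι k k u * r) * (y : Ultrapower ω E)) =
          τ (diag ω (M.ι 0 0 b) * (y : Ultrapower ω E)) := by
  obtain ⟨w, hw, rfl⟩ := hu.exists_sqrt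
  obtain ⟨v, h1, h2⟩ : ∃ v, star r * M.ι k k (w * w) * r = star v * v ∧
      v * star v = M.ι 0 0 (w * M.entry k k (r * star r) * w) := by
    refine ⟨M.ι 0 k w * r, ?_, ?_⟩
    · rw [star_mul, M.star_ι, hw, ← M.ι_mul_self k 0 k]
      simp only [mul_assoc]
    · rw [star_mul, M.star_ι, hw, ← M.ι_mul_mul_ι]
      simp only [mul_assoc]
  refine ⟨w * M.entry k k (r * star r) * w, ?_, ?_, fun y hy => ⟨?_, ?_⟩⟩
  · have := (M.isPos_entry (isPos_mul_star_self r) k).star_left_conjugate w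
    rwa [hw] at this
  · rw [h1, ← h2, diag_mul, diag_mul, ← star_diag, hτ.map_star_mul_self]
  · rw [h1]
    exact isPos_diag_mul (isPos_star_mul_self v) hy
  · obtain ⟨s, hs, rfl⟩ := hy.exists_sqrt
    have hs' : star (s : Ultrapower ω E) = s := congrArg Subtype.val hs
    have h3 := hτ.map_star_mul_self (diag ω v * (s : Ultrapower ω E))
    have hc := diag_mul_comm s
    rw [h1, ← h2]
    change τ (diag ω (star v * v) * ((s : Ultrapower ω E) * s)) =
      τ (diag ω (v * star v) * ((s : Ultrapower ω E) * s))
    convert h3 using 2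
    · rw [star_mul, hs', star_diag, diag_mul, mul_assoc, ← mul_assoc (diag ω v), hc v, ← mul_assoc,
        ← mul_assoc, hc (star v)]
      simp only [mul_assoc, hc v]
    · rw [star_mul, hs', star_diag, diag_mul]
      simp only [← hc, mul_assoc]
      rw [← mul_assoc (s : Ultrapower ω E), ← hc, mul_assoc]

/-- A relation `τ(c y) = t τ(c)` needs to be checked only in the corner `B ⊗ e_{00}`. -/
theorem trace_diag_mul_eq {τ : Ultrapower ω E → ℝ≥0∞} (hτ : IsGeneralisedLimitTrace ω τ)
    {y : RelCommutant ω E} (hy : IsPos y) {t : ℝ≥0∞} (ht : t ≠ ∞)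
    (h : ∀ b : B, IsPos b → τ (diag ω (M.ι 0 0 b)) < ∞ →
      τ (diag ω (M.ι 0 0 b) * (y : Ultrapower ω E)) = t * τ (diag ω (M.ι 0 0 b)))
    {c : E} (hc : IsPos c) (hfin : τ (diag ω c) < ∞) :
    τ (diag ω c * (y : Ultrapower ω E)) = t * τ (diag ω c) := by
  obtain ⟨r, rfl⟩ := hc
  obtain ⟨l, hl, hu, hb⟩ := exists_approximateUnit B
  -- The `c p` converge to `r* r` from below, and `exists_trace_conjugate_eq` applies to their
  -- finitely many summands.
  set c : ℕ × B → E := fun p => star r * M.blockHom p.1 p.2 * r with hc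
  have hlim : Tendsto c (atTop ×ˢ l) (𝓝 (star r * r)) := by
    simp only [hc, mul_assoc]
    exact (M.tendsto_blockHom_mul (hu.mono fun u h => h.2) hb r).const_mul _
  have hu' : ∀ᶠ p : ℕ × B in atTop ×ˢ l, IsPos p.2 ∧ ‖p.2‖ ≤ 1 := tendsto_snd.eventually hu
  have hle : ∀ (v : E), IsPos v → ‖v‖ ≤ 1 → IsPos (star r * r - star r * v * r) := by
    intro v hv hv1
    have := isPos_norm_smul_sub_conjugate hv.isSelfAdjoint hv1 r
    rwa [Complex.ofReal_one, one_smul] at this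
  have hcpos : ∀ᶠ p in atTop ×ˢ l, IsPos (c p) := by
    filter_upwards [hu'] with p hp
    exact (hp.1.map (M.blockHom p.1)).star_left_conjugate r
  have hcle : ∀ᶠ p in atTop ×ˢ l, IsPos (star r * r - c p) := by
    filter_upwards [hu'] with p hp
    exact hle _ (hp.1.map (M.blockHom p.1)) ((M.norm_blockHom_le _ _).trans hp.2)
  have hlim1 : Tendsto (fun p => τ (diag ω (c p))) (atTop ×ˢ l) (𝓝 (τ (diag ω (star r * r)))) := by
    refine hτ.tendsto_of_le ((isPos_star_mul_self r).map (diagHom ω))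
      (((continuous_diag ω).tendsto _).comp hlim) (hcpos.mono fun p hp => hp.map (diagHom ω)) ?_
    filter_upwards [hcle] with p hp
    have := hp.map (diagHom ω)
    rwa [map_sub] at this
  have hlim2 : Tendsto (fun p => τ (diag ω (c p) * (y : Ultrapower ω E))) (atTop ×ˢ l)
      (𝓝 (τ (diag ω (star r * r) * (y : Ultrapower ω E)))) := by
    refine hτ.tendsto_of_le (isPos_diag_mul (isPos_star_mul_self r) hy)
      ((((continuous_diag ω).tendsto _).comp hlim).mul_const _)
      (hcpos.mono fun p hp => isPos_diag_mul hp hy) ?_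
    filter_upwards [hcle] with p hp
    have := isPos_diag_mul (ω := ω) hp hy
    rwa [← diagHom_apply, map_sub, sub_mul] at this
  refine tendsto_nhds_unique hlim2
    ((ENNReal.Tendsto.const_mul hlim1 (Or.inr ht)).congr' ?_)
  filter_upwards [hu'] with p hp
  choose b hbpos hb1 hb2 using fun k => M.exists_trace_conjugate_eq hτ.1 hp.1 k r
  have hsum : c p = ∑ k ∈ Finset.range p.1, star r * M.ι k k p.2 * r := by
    rw [hc]
    simp only [blockHom_apply, Finset.mul_sum, Finset.sum_mul]
  have hd : diag ω (c p) = ∑ k ∈ Finset.range p.1, diag ω (star r * M.ι k k p.2 * r) := by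
    rw [hsum, ← diagHom_apply, map_sum]
    rfl
  have hpk : ∀ k, IsPos (M.ι k k p.2) := fun k => hp.1.map (M.hom k)
  have hdk : ∀ k, IsPos (diag ω (star r * M.ι k k p.2 * r)) := fun k =>
    ((hpk k).star_left_conjugate r).map (diagHom ω)
  rw [hd, Finset.sum_mul, hτ.1.map_sum fun k _ => hdk k,
    hτ.1.map_sum fun k _ => (hb2 k y hy).1, Finset.mul_sum]
  refine Finset.sum_congr rfl fun k _ => ?_
  rw [(hb2 k y hy).2, hb1 k, h (b k) (hbpos k)]
  rw [← hb1 k]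
  refine lt_of_le_of_lt (hτ.1.mono (hdk k) ?_) hfin
  have := (hle _ (hpk k) (by rw [M.norm_ι]; exact hp.2)).map (diagHom ω)
  rwa [map_sub] at this

/-- Extension of generalised limit traces from `B_ω` to `E_ω`. -/
theorem exists_extend_isGeneralisedLimitTrace {τ : Ultrapower ω B → ℝ≥0∞}
    (hτ : IsGeneralisedLimitTrace ω τ) : ∃ σ : Ultrapower ω E → ℝ≥0∞,
      IsGeneralisedLimitTrace ω σ ∧ ∀ q, IsPos q → σ (mapUltra ω (M.hom 0) q) = τ q := by
  obtain ⟨hτ, t, ht, h⟩ := hτ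
  obtain ⟨σ, hσ, hσ'⟩ := exists_isGeneralisedLimitTrace ω
    fun n => M.isLscTrace_extendTrace (ht n)
  refine ⟨σ, hσ, fun q hq => ?_⟩
  obtain ⟨x, hx, rfl⟩ := (nullIdeal ω B).exists_isPos_lift hq
  rw [mapUltra_proj, hσ' _ (hx.map _), h x hx]
  refine iSup_congr fun ε => iSup_congr fun hε => ?_
  congr 1
  funext n
  have h1 : cutDown ε (mapSeq (M.hom 0) x n) = M.ι 0 0 (cutDown ε (x n)) :=
    (map_cutDown (M.hom 0) (hx.apply n) hε.le).symm
  exact (congrArg (M.extendTrace (t n)) h1).trans (M.extendTrace_ι (ht n).map_zero _)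

theorem separableSpace_right (M : MatrixSystem B E) [TopologicalSpace.SeparableSpace B] :
    TopologicalSpace.SeparableSpace E := by
  have h1 : TopologicalSpace.IsSeparable (⋃ i, ⋃ j, Set.range (M.ι i j)) :=
    TopologicalSpace.IsSeparable.iUnion fun i => TopologicalSpace.IsSeparable.iUnion fun j =>
      TopologicalSpace.isSeparable_range (M.continuous_ι i j)
  have h2 := (h1.span (R := ℂ)).closure
  rw [← TopologicalSpace.isSeparable_univ_iff]
  refine h2.mono fun c _ => ?_
  refine closure_mono ?_ (M.dense c)
  exact AddSubmonoid.closure_le (S := (Submodule.span ℂ _).toAddSubmonoid).2 Submodule.subset_span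

theorem separableSpace_left (M : MatrixSystem B E) [TopologicalSpace.SeparableSpace E] :
    TopologicalSpace.SeparableSpace B := by
  have h : Topology.IsInducing (M.hom 0) :=
    (NonUnitalStarAlgHom.isometry (M.hom 0) (M.hom_injective 0)).isUniformInducing.isInducing
  have : SecondCountableTopology E := UniformSpace.secondCountable_of_separable E
  have := h.secondCountableTopology
  infer_instance

theorem hasStabilisedPropertyGamma_right (M : MatrixSystem B E) (hω : (ω : Filter ℕ) ≤ cofinite)
    (hB : HasStabilisedPropertyGamma ω B) : HasStabilisedPropertyGamma ω E := by
  have := hB.1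
  refine ⟨M.separableSpace_right, fun n => ?_⟩
  obtain ⟨e, he0, he1, he2, he⟩ := hB.2 n
  obtain ⟨f, hf⟩ := M.exists_hom_right hω
  refine ⟨fun i => f (e i), fun i => (he0 i).map f,
    fun i => (NonUnitalStarAlgHom.norm_apply_le f _).trans (he1 i),
    fun i j hij => by rw [← map_mul, he2 i j hij, map_zero], ?_⟩
  intro c τ hc hτ hfin i y hy hye
  obtain ⟨x, hx, hxe⟩ := (annIdeal ω B).exists_isPos_lift (he0 i)
  obtain ⟨y', h⟩ := M.exists_related_right hω x
  have h : M.Related x y := h.congr_right (by rw [hye, ← hf _ _ h, hxe])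
  refine M.trace_diag_mul_eq hτ hy ?_ (fun b hb hbfin => ?_) hc hfin
  · -- The index `i : Fin n` rules out `n = 0`, where `n⁻¹ = ∞`.
    exact ENNReal.inv_ne_top.2 (Nat.cast_ne_zero.2 i.pos.ne')
  · rw [h.diag_mul]
    exact he b _ hb (hτ.comp_mapUltra (M.hom 0)) hbfin i x hx hxe

theorem hasStabilisedPropertyGamma_left (M : MatrixSystem B E)
    (hE : HasStabilisedPropertyGamma ω E) : HasStabilisedPropertyGamma ω B := by
  have := hE.1
  refine ⟨M.separableSpace_left, fun n => ?_⟩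
  obtain ⟨e, he0, he1, he2, he⟩ := hE.2 n
  obtain ⟨f, hf⟩ := M.exists_hom_left (ω := ω)
  refine ⟨fun i => f (e i), fun i => (he0 i).map f,
    fun i => (NonUnitalStarAlgHom.norm_apply_le f _).trans (he1 i),
    fun i j hij => by rw [← map_mul, he2 i j hij, map_zero], ?_⟩
  intro b τ hb hτ hfin i x hx hxe
  obtain ⟨y, hy, hye⟩ := (annIdeal ω E).exists_isPos_lift (he0 i)
  obtain ⟨x', h⟩ := M.exists_related_left y
  have h : M.Related x y := h.congr_left (by rw [hxe, ← hf _ _ h, hye])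
  obtain ⟨σ, hσ, hστ⟩ := M.exists_extend_isGeneralisedLimitTrace hτ
  have h1 : σ (diag ω (M.ι 0 0 b)) = τ (diag ω b) := hστ _ (hb.map (diagHom ω))
  have h2 := he (M.ι 0 0 b) σ (hb.map (M.hom 0)) hσ (h1 ▸ hfin) i y hy hye
  rwa [twist, h.diag_mul, hστ _ (isPos_diag_mul hb hx), h1] at h2

end MatrixSystem

/-! ### Matrix units in the compact operators -/

section CompactK

/-- The standard basis of `ℓ²(ℕ)`. -/
def stdBasis (i : ℕ) : lp (fun _ : ℕ => ℂ) 2 := lp.single 2 i (1 : ℂ)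

theorem inner_stdBasis (i : ℕ) (f : lp (fun _ : ℕ => ℂ) 2) : ⟪stdBasis i, f⟫_ℂ = f i := by
  rw [stdBasis, lp.inner_single_left]
  simp

theorem inner_stdBasis_stdBasis (i j : ℕ) :
    ⟪stdBasis i, stdBasis j⟫_ℂ = if i = j then 1 else 0 := by
  rw [inner_stdBasis, stdBasis, lp.single_apply, Pi.single_apply]

theorem isCompactOperator_rankOne {H : Type*} [NormedAddCommGroup H] [InnerProductSpace ℂ H]
    (x y : H) : IsCompactOperator (InnerProductSpace.rankOne ℂ x y) := by
  have h : IsCompactOperator (ContinuousLinearMap.toSpanSingleton ℂ x) :=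
    ⟨_, (isCompact_closedBall (0 : ℂ) 1).image (ContinuousLinearMap.toSpanSingleton ℂ x).continuous,
      mem_of_superset (Metric.closedBall_mem_nhds 0 one_pos) (Set.subset_preimage_image _ _)⟩
  rw [InnerProductSpace.rankOne_def']
  exact h.comp_clm (innerSL ℂ y)

/-- The matrix unit `e_{ij}`. -/
def matrixUnit (i j : ℕ) : CompactK :=
  ⟨InnerProductSpace.rankOne ℂ (stdBasis i) (stdBasis j), isCompactOperator_rankOne _ _⟩

theorem matrixUnit_apply (i j : ℕ) (v : lp (fun _ : ℕ => ℂ) 2) :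
    (matrixUnit i j).1 v = ⟪stdBasis j, v⟫_ℂ • stdBasis i :=
  InnerProductSpace.rankOne_apply _ _ _

theorem compactK_ext {S T : CompactK} (h : ∀ v, S.1 v = T.1 v) : S = T :=
  Subtype.ext (ContinuousLinearMap.ext h)

theorem compactK_mul_apply (S T : CompactK) (v : lp (fun _ : ℕ => ℂ) 2) :
    (S * T).1 v = S.1 (T.1 v) := rfl

theorem matrixUnit_mul_mul (i j k l : ℕ) (T : CompactK) :
    matrixUnit i j * T * matrixUnit k l =
      ⟪stdBasis j, T.1 (stdBasis k)⟫_ℂ • matrixUnit i l := by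
  refine compactK_ext fun v => ?_
  change (matrixUnit i j).1 (T.1 ((matrixUnit k l).1 v)) =
    ⟪stdBasis j, T.1 (stdBasis k)⟫_ℂ • (matrixUnit i l).1 v
  rw [matrixUnit_apply, matrixUnit_apply, matrixUnit_apply, map_smul, inner_smul_right, smul_smul,
    mul_comm]

theorem matrixUnit_mul (i j k l : ℕ) :
    matrixUnit i j * matrixUnit k l = if j = k then matrixUnit i l else 0 := by
  refine compactK_ext fun v => ?_
  rw [compactK_mul_apply, matrixUnit_apply, matrixUnit_apply, inner_smul_right,
    inner_stdBasis_stdBasis]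
  split_ifs
  · rw [mul_one, matrixUnit_apply]
  · rw [mul_zero, zero_smul]; rfl

theorem star_matrixUnit (i j : ℕ) : star (matrixUnit i j) = matrixUnit j i :=
  Subtype.ext (InnerProductSpace.adjoint_rankOne _ _)

/-- The projection of `ℓ²(ℕ)` onto the span of the first `n` basis vectors. -/
def cornerProj (n : ℕ) : CompactK := ∑ k ∈ Finset.range n, matrixUnit k k

theorem cornerProj_mul_self (n : ℕ) : cornerProj n * cornerProj n = cornerProj n := by
  rw [cornerProj, Finset.sum_mul_sum]
  refine Finset.sum_congr rfl fun i hi => ?_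
  simp only [matrixUnit_mul]
  rw [Finset.sum_ite_eq, if_pos hi]

theorem star_cornerProj (n : ℕ) : star (cornerProj n) = cornerProj n := by
  simp only [cornerProj, star_sum, star_matrixUnit]

theorem norm_cornerProj_le (n : ℕ) : ‖cornerProj n‖ ≤ 1 := by
  have h := CStarRing.norm_star_mul_self (x := cornerProj n)
  rw [star_cornerProj, cornerProj_mul_self] at h
  by_contra! h1
  nlinarith

theorem tendsto_cornerProj_apply (v : lp (fun _ : ℕ => ℂ) 2) :
    Tendsto (fun n => (cornerProj n).1 v) atTop (𝓝 v) := by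
  refine (lp.hasSum_single (by simp) v).tendsto_sum_nat.congr fun n => ?_
  have h : (cornerProj n).1 = ∑ k ∈ Finset.range n, (matrixUnit k k).1 := by
    rw [cornerProj]
    exact AddSubmonoidClass.coe_finsetSum _ _
  rw [h, sum_apply]
  refine Finset.sum_congr rfl fun k _ => ?_
  rw [matrixUnit_apply, inner_stdBasis, stdBasis, ← lp.single_smul, smul_eq_mul, mul_one]

/-- The projections `cornerProj n` converge to the identity pointwise, hence uniformly on the totally
bounded image of a ball under a compact operator. -/
theorem tendsto_cornerProj_mul (T : CompactK) :
    Tendsto (fun n => cornerProj n * T) atTop (𝓝 T) := by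
  refine Metric.tendsto_nhds.2 fun ε hε => ?_
  have tb := (T.2.isCompact_closure_image_ball
    (f := (T.1 : lp (fun _ : ℕ => ℂ) 2 →ₗ[ℂ] lp (fun _ : ℕ => ℂ) 2)) 2).totallyBounded.subset
    subset_closure
  obtain ⟨t, htf, ht⟩ := Metric.totallyBounded_iff.1 tb (ε / 4) (by positivity)
  have h1 : ∀ᶠ n in atTop, ∀ z ∈ t, dist ((cornerProj n).1 z) z < ε / 4 :=
    (eventually_all_finite htf).2 fun z _ =>
      (Metric.tendsto_nhds.1 (tendsto_cornerProj_apply z)) (ε / 4) (by positivity)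
  filter_upwards [h1] with n hn
  have h2 : ‖(cornerProj n * T - T).1‖ ≤ 3 * (ε / 4) := by
    refine ContinuousLinearMap.opNorm_le_of_unit_norm (by positivity) fun v hv => ?_
    have h3 := ht ⟨v, by rw [mem_ball_zero_iff, hv]; norm_num, rfl⟩
    simp only [Set.mem_iUnion, Metric.mem_ball] at h3
    obtain ⟨z, hz, h3⟩ := h3
    have h4 := hn z hz
    change ‖(cornerProj n).1 (T.1 v) - T.1 v‖ ≤ _
    change dist (T.1 v) z < ε / 4 at h3
    rw [dist_eq_norm] at h3 h4
    have h5 : (cornerProj n).1 (T.1 v) - T.1 v =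
        (cornerProj n).1 (T.1 v - z) + ((cornerProj n).1 z - z) - (T.1 v - z) := by
      rw [map_sub]; abel
    have h6 : ‖(cornerProj n).1 (T.1 v - z)‖ ≤ ‖T.1 v - z‖ :=
      ((cornerProj n).1.le_of_opNorm_le (norm_cornerProj_le n) _).trans_eq (one_mul _)
    rw [h5]
    have h7 := norm_sub_le ((cornerProj n).1 (T.1 v - z) + ((cornerProj n).1 z - z)) (T.1 v - z)
    have h8 := norm_add_le ((cornerProj n).1 (T.1 v - z)) ((cornerProj n).1 z - z)
    linarith
  rw [dist_eq_norm]
  change ‖(cornerProj n * T - T).1‖ < ε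
  linarith

theorem tendsto_cornerProj_mul_mul (T : CompactK) :
    Tendsto (fun n => cornerProj n * T * cornerProj n) atTop (𝓝 T) := by
  have h1 : Tendsto (fun n => T * cornerProj n) atTop (𝓝 T) := by
    have := (continuous_star.tendsto _).comp (tendsto_cornerProj_mul (star T))
    rw [star_star] at this
    refine this.congr fun n => ?_
    rw [Function.comp_apply, star_mul, star_star, star_cornerProj]
  have h2 : Tendsto (fun n => cornerProj n * (T * cornerProj n - T)) atTop (𝓝 0) := by
    refine squeeze_zero_norm (fun n => ?_) (tendsto_iff_norm_sub_tendsto_zero.1 h1)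
    exact (norm_mul_le _ _).trans (mul_le_of_le_one_left (norm_nonneg _) (norm_cornerProj_le n))
  have h3 := h2.add (tendsto_cornerProj_mul T)
  rw [zero_add] at h3
  refine h3.congr fun n => ?_
  rw [mul_sub, sub_add_cancel, mul_assoc]

theorem cornerProj_mul_mul_cornerProj (n : ℕ) (T : CompactK) :
    cornerProj n * T * cornerProj n = ∑ k ∈ Finset.range n, ∑ l ∈ Finset.range n,
      ⟪stdBasis k, T.1 (stdBasis l)⟫_ℂ • matrixUnit k l := by
  simp only [cornerProj, Finset.sum_mul, Finset.mul_sum, matrixUnit_mul_mul]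
  exact Finset.sum_comm

end CompactK

/-! ### The corner seminorm -/

section Compress

section Scalar
open scoped ComplexOrder

/-- The upper left `n × n` corner of a compact operator. -/
def scalarCorner (n : ℕ) (S : CompactK) : CStarMatrix (Fin n) (Fin n) ℂ :=
  CStarMatrix.ofMatrix fun k l => ⟪stdBasis k, S.1 (stdBasis l)⟫_ℂ

theorem scalarCorner_apply (n : ℕ) (S : CompactK) (k l : Fin n) :
    scalarCorner n S k l = ⟪stdBasis k, S.1 (stdBasis l)⟫_ℂ := rfl

/-- The inclusion of the `n × n` matrices in the compact operators, onto the corner given by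
`cornerProj n`. -/
def scalarHom (n : ℕ) : CStarMatrix (Fin n) (Fin n) ℂ →⋆ₙₐ[ℂ] CompactK where
  toFun t := ∑ k : Fin n, ∑ l : Fin n, t k l • matrixUnit k l
  map_smul' c t := by
    simp only [Finset.smul_sum, smul_smul]
    rfl
  map_zero' := by simp
  map_add' s t := by simp only [CStarMatrix.add_apply, add_smul, Finset.sum_add_distrib]
  map_mul' s t := by
    have h (k m i l : Fin n) : (s k m • matrixUnit k m) * (t i l • matrixUnit i l) =
        if m = i then (s k m * t i l) • matrixUnit k l else 0 := by
      rw [smul_mul_smul_comm, matrixUnit_mul, smul_ite, smul_zero]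
      simp only [Fin.val_inj]
    rw [Finset.sum_mul]
    refine Finset.sum_congr rfl fun k _ => ?_
    simp only [CStarMatrix.mul_apply, Finset.sum_smul]
    rw [Finset.sum_mul, Finset.sum_comm]
    refine Finset.sum_congr rfl fun m _ => ?_
    simp only [Finset.mul_sum, h]
    rw [Finset.sum_comm]
    refine Finset.sum_congr rfl fun l _ => ?_
    rw [Finset.sum_ite_eq, if_pos (Finset.mem_univ _)]
  map_star' t := by
    simp only [star_sum, star_smul, star_matrixUnit, CStarMatrix.star_apply]
    exact Finset.sum_comm

theorem scalarHom_scalarCorner (n : ℕ) (S : CompactK) :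
    scalarHom n (scalarCorner n S) = cornerProj n * S * cornerProj n := by
  let f (k l : ℕ) : CompactK := ⟪stdBasis k, S.1 (stdBasis l)⟫_ℂ • matrixUnit k l
  have h : scalarHom n (scalarCorner n S) = ∑ k : Fin n, ∑ l : Fin n, f k l := rfl
  rw [h, cornerProj_mul_mul_cornerProj, Finset.sum_range]
  exact Finset.sum_congr rfl fun k _ => (Finset.sum_range (f k)).symm

theorem scalarCorner_scalarHom (n : ℕ) (t : CStarMatrix (Fin n) (Fin n) ℂ) :
    scalarCorner n (scalarHom n t) = t := by
  ext i j
  have h : (scalarHom n t).1 = ∑ k : Fin n, ∑ l : Fin n, t k l • (matrixUnit k l).1 := by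
    refine (AddSubmonoidClass.coe_finsetSum _ _).trans (Finset.sum_congr rfl fun k _ => ?_)
    exact AddSubmonoidClass.coe_finsetSum _ _
  rw [scalarCorner_apply, h]
  simp only [sum_apply, smul_apply, matrixUnit_apply, inner_sum,
    inner_smul_right, inner_stdBasis_stdBasis, Fin.val_inj]
  simp

/-- As `scalarHom n` is isometric, the norm of the corner of `S` is that of `cornerProj n * S *
cornerProj n`. -/
theorem norm_scalarCorner_le (n : ℕ) (S : CompactK) : ‖scalarCorner n S‖ ≤ ‖S‖ := by
  have hinj : Function.Injective (scalarHom n) :=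
    Function.LeftInverse.injective (scalarCorner_scalarHom n)
  rw [← NonUnitalStarAlgHom.norm_map _ hinj, scalarHom_scalarCorner]
  have h1 := norm_cornerProj_le n
  calc ‖cornerProj n * S * cornerProj n‖ ≤ ‖cornerProj n * S‖ :=
        (norm_mul_le _ _).trans (mul_le_of_le_one_right (norm_nonneg _) h1)
    _ ≤ ‖S‖ := (norm_mul_le _ _).trans (mul_le_of_le_one_left (norm_nonneg _) h1)

theorem norm_map_scalar_le {A : Type*} [CStarAlgebra A] [PartialOrder A] [StarOrderedRing A]
    (n : ℕ) (t : CStarMatrix (Fin n) (Fin n) ℂ) :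
    ‖CStarMatrix.mapₙₐ ((StarAlgHom.ofId ℂ A : ℂ →⋆ₐ[ℂ] A) : ℂ →⋆ₙₐ[ℂ] A) t‖ ≤ ‖t‖ :=
  NonUnitalStarAlgHom.norm_apply_le _ _

end Scalar

/-- The diagonal embedding of an algebra in its matrices. -/
def diagMatrixHom (A : Type*) [NonUnitalCStarAlgebra A] (n : ℕ) :
    A →⋆ₙₐ[ℂ] CStarMatrix (Fin n) (Fin n) A where
  toFun a := CStarMatrix.ofMatrix (Matrix.diagonal fun _ => a)
  map_smul' c a := by ext i j; by_cases h : i = j <;> simp [h]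
  map_zero' := by ext i j; simp
  map_add' a b := by ext i j; by_cases h : i = j <;> simp [h]
  map_mul' a b := by
    ext i j
    by_cases h : i = j <;> simp [CStarMatrix.mul_apply, Matrix.diagonal_apply, h]
  map_star' a := by
    ext i j
    by_cases h : i = j
    · simp [CStarMatrix.star_apply, h]
    · simp [CStarMatrix.star_apply, h, Ne.symm h]

variable {A : Type*} [NonUnitalCStarAlgebra A]

/-- The upper left `n × n` corner of an element of `A ⊙ 𝕂`. -/
def corner (n : ℕ) : A ⊗[ℂ] CompactK →ₗ[ℂ] CStarMatrix (Fin n) (Fin n) A :=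
  TensorProduct.lift (LinearMap.mk₂ ℂ
    (fun a S => CStarMatrix.ofMatrix fun k l => ⟪stdBasis k, S.1 (stdBasis l)⟫_ℂ • a)
    (fun a b S => by ext k l; exact smul_add _ a b)
    (fun c a S => by ext k l; exact smul_comm _ c a)
    (fun a S T => by
      ext k l
      change ⟪stdBasis k, S.1 (stdBasis l) + T.1 (stdBasis l)⟫_ℂ • a = _
      rw [inner_add_right, add_smul]
      rfl)
    (fun c a S => by
      ext k l
      change ⟪stdBasis k, c • S.1 (stdBasis l)⟫_ℂ • a = _
      rw [inner_smul_right, mul_smul]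
      rfl))

theorem corner_tmul_apply (n : ℕ) (a : A) (S : CompactK) (k l : Fin n) :
    corner n (a ⊗ₜ S) k l = ⟪stdBasis k, S.1 (stdBasis l)⟫_ℂ • a := rfl

theorem corner_star (n : ℕ) (x : A ⊗[ℂ] CompactK) : corner n (star x) = star (corner n x) := by
  induction x using TensorProduct.induction_on with
  | zero => simp
  | add x y hx hy => rw [star_add, map_add, map_add, hx, hy, star_add]
  | tmul a S =>
    rw [TensorProduct.star_tmul]
    ext k l
    rw [CStarMatrix.star_apply, corner_tmul_apply, corner_tmul_apply, star_smul]
    congr 1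
    change ⟪stdBasis k, (ContinuousLinearMap.adjoint S.1) (stdBasis l)⟫_ℂ = _
    rw [ContinuousLinearMap.adjoint_inner_right, Complex.star_def, inner_conj_symm]

/-- Multiplying corners inserts the projection `cornerProj n`. -/
theorem corner_tmul_mul (n : ℕ) (a b : A) (S T : CompactK) :
    corner n (a ⊗ₜ S) * corner n (b ⊗ₜ T) = corner n ((a * b) ⊗ₜ (S * (cornerProj n * T))) := by
  ext k l
  rw [CStarMatrix.mul_apply, corner_tmul_apply]
  simp only [corner_tmul_apply, smul_mul_smul_comm]
  rw [← Finset.sum_smul]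
  congr 1
  have h : ∀ v, (cornerProj n).1 v = ∑ m : Fin n, ⟪stdBasis m, v⟫_ℂ • stdBasis m := by
    intro v
    have h : (cornerProj n).1 = ∑ k ∈ Finset.range n, (matrixUnit k k).1 := by
      rw [cornerProj]
      exact AddSubmonoidClass.coe_finsetSum _ _
    rw [h, sum_apply, Fin.sum_univ_eq_sum_range (fun m => ⟪stdBasis m, v⟫_ℂ • stdBasis m)]
    exact Finset.sum_congr rfl fun m _ => matrixUnit_apply m m v
  rw [compactK_mul_apply, compactK_mul_apply, h, map_sum, inner_sum]
  refine Finset.sum_congr rfl fun m _ => ?_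
  rw [map_smul, inner_smul_right, mul_comm]

variable [PartialOrder A] [StarOrderedRing A]

/-- Over the unitization of `A`, the corner of `a ⊗ S` is the product of the diagonal matrix with
entries `a` and the scalar corner of `S`. -/
theorem norm_corner_tmul_le (n : ℕ) (a : A) (S : CompactK) :
    ‖corner n (a ⊗ₜ[ℂ] S)‖ ≤ ‖a‖ * ‖S‖ := by
  let φ : A →⋆ₙₐ[ℂ] Unitization ℂ A := Unitization.inrNonUnitalStarAlgHom ℂ A
  have hφ : Function.Injective (CStarMatrix.mapₙₐ (n := Fin n) φ) :=
    CStarMatrix.map_injective Unitization.inr_injective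
  rw [← NonUnitalStarAlgHom.norm_map _ hφ]
  have h : CStarMatrix.mapₙₐ φ (corner n (a ⊗ₜ[ℂ] S)) = diagMatrixHom (Unitization ℂ A) n a *
      CStarMatrix.mapₙₐ ((StarAlgHom.ofId ℂ (Unitization ℂ A) : ℂ →⋆ₐ[ℂ] Unitization ℂ A) :
        ℂ →⋆ₙₐ[ℂ] Unitization ℂ A) (scalarCorner n S) := by
    ext1 k l
    rw [CStarMatrix.mul_apply, Finset.sum_eq_single k]
    · change ((⟪stdBasis k, S.1 (stdBasis l)⟫_ℂ • a : A) : Unitization ℂ A) =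
        Matrix.diagonal (fun _ => (a : Unitization ℂ A)) k k *
          algebraMap ℂ (Unitization ℂ A) ⟪stdBasis k, S.1 (stdBasis l)⟫_ℂ
      rw [Matrix.diagonal_apply_eq, ← Algebra.commutes, ← Algebra.smul_def, Unitization.inr_smul]
    · intro m _ hm
      change Matrix.diagonal (fun _ => (a : Unitization ℂ A)) k m * _ = 0
      rw [Matrix.diagonal_apply_ne _ hm.symm, zero_mul]
    · simp
  rw [h]
  refine (norm_mul_le _ _).trans (mul_le_mul ?_ ((norm_map_scalar_le n _).trans
    (norm_scalarCorner_le n S)) (norm_nonneg _) (norm_nonneg _))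
  refine (NonUnitalStarAlgHom.norm_apply_le _ _).trans ?_
  rw [Unitization.norm_inr]

theorem exists_norm_corner_le (x : A ⊗[ℂ] CompactK) : ∃ C, ∀ n, ‖corner n x‖ ≤ C := by
  induction x using TensorProduct.induction_on with
  | zero => exact ⟨0, fun n => by simp⟩
  | tmul a S => exact ⟨_, fun n => norm_corner_tmul_le n a S⟩
  | add x y hx hy =>
    obtain ⟨C, hC⟩ := hx
    obtain ⟨D, hD⟩ := hy
    refine ⟨C + D, fun n => ?_⟩
    rw [map_add]
    exact (norm_add_le _ _).trans (add_le_add (hC n) (hD n))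

theorem tendsto_norm_sub_mul_cornerProj_mul (S T : CompactK) :
    Tendsto (fun n => ‖S * T - S * (cornerProj n * T)‖) atTop (𝓝 0) := by
  have h : Tendsto (fun n => ‖S‖ * ‖cornerProj n * T - T‖) atTop (𝓝 (‖S‖ * 0)) :=
    (tendsto_iff_norm_sub_tendsto_zero.1 (tendsto_cornerProj_mul T)).const_mul ‖S‖
  rw [mul_zero] at h
  refine squeeze_zero (fun n => norm_nonneg _) (fun n => ?_) h
  rw [← mul_sub, norm_sub_rev (cornerProj n * T)]
  exact norm_mul_le _ _

/-- The defect `(x y)_n - x_n y_n` of multiplicativity of taking corners, as a bilinear map. -/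
def cornerDefect (n : ℕ) :
    A ⊗[ℂ] CompactK →ₗ[ℂ] A ⊗[ℂ] CompactK →ₗ[ℂ] CStarMatrix (Fin n) (Fin n) A :=
  (LinearMap.mul ℂ (A ⊗[ℂ] CompactK)).compr₂ (corner n) -
    (LinearMap.mul ℂ (CStarMatrix (Fin n) (Fin n) A)).compl₁₂ (corner n) (corner n)

theorem norm_cornerDefect_tmul_le (n : ℕ) (a b : A) (S T : CompactK) :
    ‖cornerDefect n (a ⊗ₜ[ℂ] S) (b ⊗ₜ[ℂ] T)‖ ≤
      ‖a * b‖ * ‖S * T - S * (cornerProj n * T)‖ := by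
  refine le_trans (le_of_eq ?_) (norm_corner_tmul_le n _ _)
  rw [TensorProduct.tmul_sub, map_sub, ← corner_tmul_mul, ← Algebra.TensorProduct.tmul_mul_tmul]
  rfl

/-- Taking corners is asymptotically multiplicative. -/
theorem tendsto_cornerDefect (x y : A ⊗[ℂ] CompactK) :
    Tendsto (fun n => ‖cornerDefect n x y‖) atTop (𝓝 0) := by
  induction x using TensorProduct.induction_on with
  | zero => simp
  | add x x' hx hx' =>
    refine squeeze_zero (fun n => norm_nonneg _) (fun n => ?_) (add_zero (0 : ℝ) ▸ hx.add hx')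
    rw [map_add, LinearMap.add_apply]
    exact norm_add_le _ _
  | tmul a S =>
    induction y using TensorProduct.induction_on with
    | zero => simp
    | add y y' hy hy' =>
      refine squeeze_zero (fun n => norm_nonneg _) (fun n => ?_) (add_zero (0 : ℝ) ▸ hy.add hy')
      rw [map_add]
      exact norm_add_le _ _
    | tmul b T =>
      have h := (tendsto_norm_sub_mul_cornerProj_mul S T).const_mul ‖a * b‖
      rw [mul_zero] at h
      exact squeeze_zero (fun n => norm_nonneg _)
        (fun n => norm_cornerDefect_tmul_le n a b S T) h

/-- The limit of the norms of the corners of `x`, along some free ultrafilter on `ℕ`. It exists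
because the norms are bounded: `tendsto_cornerNorm`. -/
def cornerNorm (x : A ⊗[ℂ] CompactK) : ℝ :=
  limUnder (hyperfilter ℕ : Filter ℕ) fun n => ‖corner n x‖

theorem tendsto_cornerNorm (x : A ⊗[ℂ] CompactK) :
    Tendsto (fun n => ‖corner n x‖) (hyperfilter ℕ) (𝓝 (cornerNorm x)) := by
  obtain ⟨C, hC⟩ := exists_norm_corner_le x
  obtain ⟨r, -, hr⟩ := (isCompact_Icc (a := (0 : ℝ)) (b := C)).ultrafilter_le_nhds
    ((hyperfilter ℕ).map fun n => ‖corner n x‖)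
    (le_principal_iff.2 (mem_map.2 (univ_mem' fun n => ⟨norm_nonneg _, hC n⟩)))
  exact tendsto_nhds_limUnder ⟨r, hr⟩

theorem hyperfilter_le_atTop : (hyperfilter ℕ : Filter ℕ) ≤ atTop :=
  Nat.cofinite_eq_atTop ▸ hyperfilter_le_cofinite

theorem tendsto_norm_corner_mul (x y : A ⊗[ℂ] CompactK) :
    Tendsto (fun n => ‖corner n x * corner n y‖) (hyperfilter ℕ) (𝓝 (cornerNorm (x * y))) := by
  have h : Tendsto (fun n => ‖corner n (x * y) - corner n x * corner n y‖) (hyperfilter ℕ)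
      (𝓝 0) :=
    (tendsto_cornerDefect x y).mono_left hyperfilter_le_atTop
  have h1 : Tendsto (fun n => ‖corner n x * corner n y‖ - ‖corner n (x * y)‖) (hyperfilter ℕ)
      (𝓝 0) := by
    refine squeeze_zero_norm (fun n => ?_) h
    rw [norm_sub_rev (corner n (x * y))]
    exact abs_norm_sub_norm_le _ _
  have h2 := h1.add (tendsto_cornerNorm (x * y))
  simpa using h2

variable (A) in
/-- The seminorm `cornerNorm` is one of the C*-seminorms on `A ⊙ 𝕂` over which the maximal C*-norm
is the supremum, and it does not vanish on `a ⊗ e_{00}` for `a ≠ 0`. -/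
theorem exists_cornerSeminorm : ∃ p ∈ cstarSeminorms A CompactK,
    ∀ a : A, ‖a‖ ≤ p (a ⊗ₜ[ℂ] matrixUnit 0 0) := by
  refine ⟨Seminorm.of cornerNorm (fun x y => ?_) (fun c x => ?_), ⟨fun x y => ?_, fun x => ?_,
    fun a S => ?_⟩, fun a => ?_⟩
  · refine le_of_tendsto_of_tendsto' (tendsto_cornerNorm _)
      ((tendsto_cornerNorm x).add (tendsto_cornerNorm y)) fun n => ?_
    rw [map_add]
    exact norm_add_le _ _
  · refine tendsto_nhds_unique (tendsto_cornerNorm _) (((tendsto_cornerNorm x).const_mul ‖c‖).congr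
      fun n => ?_)
    rw [map_smul, norm_smul]
  · exact le_of_tendsto_of_tendsto' (tendsto_norm_corner_mul x y)
      ((tendsto_cornerNorm x).mul (tendsto_cornerNorm y)) fun n => norm_mul_le _ _
  · refine tendsto_nhds_unique (tendsto_norm_corner_mul (star x) x)
      (((tendsto_cornerNorm x).pow 2).congr fun n => ?_)
    rw [corner_star, CStarRing.norm_star_mul_self, sq]
  · exact le_of_tendsto' (tendsto_cornerNorm _) fun n => norm_corner_tmul_le n a S
  · refine ge_of_tendsto (tendsto_cornerNorm _) ?_
    filter_upwards [hyperfilter_le_atTop (eventually_gt_atTop 0)] with n hn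
    refine le_trans (le_of_eq ?_) (CStarMatrix.norm_entry_le_norm (i := ⟨0, hn⟩) (j := ⟨0, hn⟩))
    rw [corner_tmul_apply, matrixUnit_apply, inner_smul_right, inner_stdBasis_stdBasis]
    simp

end Compress

/-! ### The matrix system of the stabilisation -/

section Stabilisation
variable (A : Type*) [NonUnitalCStarAlgebra A]

/-- The embedding `a ↦ a ⊗ e_{ij}` of `A` in its stabilisation. -/
def stabι (i j : ℕ) : A →ₗ[ℂ] Stabilisation A :=
  (MaxTensor.ofAlg (A := A) (B := CompactK)).toLinearMap ∘ₗ
    ((TensorProduct.mk ℂ A CompactK).flip (matrixUnit i j) : A →ₗ[ℂ] AlgTensor A CompactK)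

variable {A}

/-- Half of the cross norm property, which is built into the definition of the maximal C*-norm. -/
theorem norm_ofAlg_tmul_le (a : A) (S : CompactK) :
    ‖MaxTensor.ofAlg (a ⊗ₜ[ℂ] S : A ⊗[ℂ] CompactK)‖ ≤ ‖a‖ * ‖S‖ :=
  (MaxTensor.norm_ofAlg _).trans_le (maxNorm_le fun p => p.2.2.2 a S)

theorem dense_stabι :
    Dense (AddSubmonoid.closure (⋃ i, ⋃ j, Set.range (stabι A i j)) : Set (Stabilisation A)) := by
  set D := AddSubmonoid.closure (⋃ i, ⋃ j, Set.range (stabι A i j)) with hD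
  have hmem : ∀ i j a, stabι A i j a ∈ D := fun i j a =>
    AddSubmonoid.subset_closure (Set.mem_iUnion₂.2 ⟨i, j, a, rfl⟩)
  suffices h : ∀ x : A ⊗[ℂ] CompactK, MaxTensor.ofAlg x ∈ D.topologicalClosure by
    intro z
    exact closure_minimal (Set.range_subset_iff.2 h) D.isClosed_topologicalClosure
      (MaxTensor.denseRange_ofAlg z)
  intro x
  induction x using TensorProduct.induction_on with
  | zero =>
    have : MaxTensor.ofAlg (0 : A ⊗[ℂ] CompactK) = 0 := map_zero MaxTensor.ofAlg
    rw [this]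
    exact zero_mem _
  | add x y hx hy =>
    have : MaxTensor.ofAlg (x + y : A ⊗[ℂ] CompactK) = MaxTensor.ofAlg x + MaxTensor.ofAlg y :=
      map_add MaxTensor.ofAlg x y
    rw [this]
    exact add_mem hx hy
  | tmul a S =>
    let f : CompactK →ₗ[ℂ] Stabilisation A :=
      (MaxTensor.ofAlg (A := A) (B := CompactK)).toLinearMap ∘ₗ
        (TensorProduct.mk ℂ A CompactK a : CompactK →ₗ[ℂ] AlgTensor A CompactK)
    have hf : Continuous f := AddMonoidHomClass.continuous_of_bound f ‖a‖ (norm_ofAlg_tmul_le a)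
    refine mem_closure_of_tendsto ((hf.tendsto S).comp (tendsto_cornerProj_mul_mul S))
      (Eventually.of_forall fun n => ?_)
    rw [Function.comp_apply, cornerProj_mul_mul_cornerProj, map_sum]
    refine sum_mem fun k _ => ?_
    rw [map_sum]
    refine sum_mem fun l _ => ?_
    rw [map_smul]
    -- The set `D` absorbs scalars, because `stabι A k l` is linear.
    change _ • stabι A k l a ∈ D
    rw [← map_smul]
    exact hmem _ _ _

variable (A) in
/-- The matrix units `a ⊗ e_{ij}` in the stabilisation of `A`. -/
def stabSystem : MatrixSystem A (Stabilisation A) where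
  ι := stabι A
  ι_mul i j k l a b := by
    refine (MaxTensor.ofAlg_mul _ _).symm.trans ?_
    change MaxTensor.ofAlg
      (a ⊗ₜ[ℂ] matrixUnit i j * b ⊗ₜ[ℂ] matrixUnit k l : A ⊗[ℂ] CompactK) = _
    rw [Algebra.TensorProduct.tmul_mul_tmul, matrixUnit_mul]
    split_ifs
    · rfl
    · rw [TensorProduct.tmul_zero]
      exact map_zero MaxTensor.ofAlg
  star_ι i j a := by
    refine (MaxTensor.ofAlg_star _).symm.trans ?_
    have h : star (a ⊗ₜ[ℂ] matrixUnit i j : A ⊗[ℂ] CompactK) = star a ⊗ₜ[ℂ] matrixUnit j i := by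
      rw [TensorProduct.star_tmul, star_matrixUnit]
    exact congrArg (MaxTensor.ofAlg (A := A) (B := CompactK)) h
  dense := dense_stabι
  injective := by
    let : PartialOrder A := CStarAlgebra.spectralOrder _
    have : StarOrderedRing A := CStarAlgebra.spectralOrderedRing _
    refine (injective_iff_map_eq_zero _).2 fun a ha => ?_
    obtain ⟨p, hp, hpa⟩ := exists_cornerSeminorm A
    have h := (hpa a).trans (le_maxNorm ⟨p, hp⟩ _)
    have h2 : ‖stabι A 0 0 a‖ = maxNorm (a ⊗ₜ[ℂ] matrixUnit 0 0) := MaxTensor.norm_ofAlg _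
    rw [← h2, ha, norm_zero] at h
    exact norm_le_zero_iff.1 h

/-- Transport of a matrix system along an isomorphism. -/
def MatrixSystem.mapEquiv {B E F : Type*} [NonUnitalCStarAlgebra B] [NonUnitalCStarAlgebra E]
    [NonUnitalCStarAlgebra F] (M : MatrixSystem B E) (Φ : E ≃⋆ₐ[ℂ] F) : MatrixSystem B F where
  ι i j := ((Φ : E →⋆ₙₐ[ℂ] F) : E →ₗ[ℂ] F) ∘ₗ M.ι i j
  ι_mul i j k l a b := by
    change Φ (M.ι i j a) * Φ (M.ι k l b) = _
    rw [← map_mul, M.ι_mul]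
    split_ifs
    · rfl
    · exact map_zero Φ
  star_ι i j a := by
    change star (Φ (M.ι i j a)) = Φ (M.ι j i (star a))
    rw [← map_star, M.star_ι]
  dense := by
    have hΦ : Continuous Φ := AddMonoidHomClass.continuous_of_bound Φ 1 fun x => by
      rw [one_mul]
      exact NonUnitalStarAlgHom.norm_apply_le Φ x
    refine (Φ.surjective.denseRange.dense_image hΦ M.dense).mono ?_
    rintro _ ⟨x, hx, rfl⟩
    induction hx using AddSubmonoid.closure_induction with
    | mem x hx =>
      obtain ⟨i, j, a, rfl⟩ := Set.mem_iUnion₂.1 hx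
      exact AddSubmonoid.subset_closure (Set.mem_iUnion₂.2 ⟨i, j, a, rfl⟩)
    | zero => rw [map_zero]; exact zero_mem _
    | add x y _ _ hx hy => rw [map_add]; exact add_mem hx hy
  injective := Φ.injective.comp M.injective

end Stabilisation

end StabilisedGamma

end

theorem mainTheorem3 (ω : Ultrafilter ℕ) (hω : (ω : Filter ℕ) ≤ Filter.cofinite)
    (A B : Type*) [NonUnitalCStarAlgebra A] [NonUnitalCStarAlgebra B]
    (hA : StabilisedGamma.HasStabilisedPropertyGamma ω A)
    (hAB : StabilisedGamma.StablyIsomorphic A B) :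
    StabilisedGamma.HasStabilisedPropertyGamma ω B := by
  obtain ⟨Φ⟩ := hAB
  exact (StabilisedGamma.stabSystem B).hasStabilisedPropertyGamma_left
    (((StabilisedGamma.stabSystem A).mapEquiv Φ).hasStabilisedPropertyGamma_right hω hA)
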